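/- Let $(\mathcal C,\mathbb E,\mathfrak s)$ be a small extriangulated category (in the sense of Nakaoka–Palu) with enough $\mathbb E$-projectives and enough $\mathbb E$-injectives, and let $n\ge 0$. For $k\ge 1$ write $\mathbb E^{k}(X,Y)=\mathbb E(X,\Sigma^{k-1}Y)$ for the higher extension groups, where $\Sigma Y$ is a cosyzygy of $Y$, that is, there is a conflation $Y\to I\to \Sigma Y$ with $I$ an $\mathbb E$-injective object. Let $\mathcal X\subseteq\mathcal C$ be an $(n+2)$-cluster tilting subcategory, that is: * every $C\in\mathcal C$ admits a conflation $K\to X\xrightarrow{g} C$ with $X\in\mathcal X$ and $g$ an $\mathcal X$-precover, and a conflation $C\xrightarrow{f} X'\to L$ with $X'\in\mathcal X$ and $f$ an $\mathcal X$-preenvelope; * $\mathcal X=\{Y:\mathbb E^{k}(\mathcal X,Y)=0,\ 1\le k\le n+1\}=\{Y:\mathbb E^{k}(Y,\mathcal X)=0,\ 1\le k\le n+1\}$. Let $\mathcal D:=\mathcal C/[\mathcal X]$ be the quotient of $\mathcal C$ by the ideal $[\mathcal X]$ of the morphisms that factor through objects of $\mathcal X$. Let $\mathcal X_n^{\vee}$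 (respectively $\mathcal X_n^{\wedge}$) be the full subcategory of the objects of $\mathcal C$ that have an $\mathcal X$-coresolution (respectively $\mathcal X$-resolution) of length at most $n$, built from conflations. Let $\underline{\mathcal X_n^{\vee}}$ be the quotient of $\mathcal X_n^{\vee}$ by the ideal of its morphisms $f$ with $\mathbb E(f,-)=0$, and let $\overline{\mathcal X_n^{\wedge}}$ be the quotient of $\mathcal X_n^{\wedge}$ by the ideal of its morphisms $f$ with $\mathbb E(-,f)=0$. Consider the additive functors $$\mathbb F:\mathcal D\to \mathsf{Mod}\,\underline{\mathcal X_n^{\vee}},\quad M\mapsto \mathbb E(-,M)|_{\mathcal X_n^{\vee}},\qquad \mathbb K:\mathcal D^{op}\to \overline{\mathcal X_n^{\wedge}}\,\mathsf{Mod},\quad M\mapsto \mathbb E(M,-)|_{\mathcal X_n^{\wedge}}$$ (a right module over a category is a contravariant additive functor to abelian groups, a left module is a covariant one). Let $\varepsilon_{\mathbb F}$ be the class of the sequences $A'\to A\to A''$ in $\mathcal D$ such that $0\to\mathbb F(A')\to\mathbb F(A)\to\mathbb F(A'')\to0$ is exact, and let $\varepsilon_{\mathbb K}$ be the class of the sequences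 $A'\to A\to A''$ in $\mathcal D$ such that $0\to\mathbb K(A'')\to\mathbb K(A)\to\mathbb K(A')\to0$ is exact. Then $(\mathcal D_1,\varepsilon_1):=(\mathcal D,\varepsilon_{\mathbb F})$ and $(\mathcal D_2,\varepsilon_2):=(\mathcal D,\varepsilon_{\mathbb K})$ are weakly idempotent complete exact categories. Let $\varepsilon_i(\mathcal D_i)$ be the category whose objects are the conflations of $(\mathcal D_i,\varepsilon_i)$ and whose morphisms are the morphisms of complexes, and let $\mathcal S(\mathcal D_i)$ be the class of the split conflations of $(\mathcal D_i,\varepsilon_i)$. The following statements hold. (a) $\mathcal S(\mathcal D_1)=\mathcal S(\mathcal D_2)$. (b) The quotient categories $\varepsilon_1(\mathcal D_1)/[\mathcal S(\mathcal D_1)]$ and $\varepsilon_2(\mathcal D_2)/[\mathcal S(\mathcal D_2)]$ are abelian. -/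

import Mathlib

open CategoryTheory CategoryTheory.Limits Opposite

universe u

namespace ExtriCat

noncomputable section

/-! ### Ideals of a preadditive category and their quotient categories -/

section Ideals

variable {A : Type*} [Category A] [Preadditive A]

/-- A two-sided ideal of the preadditive category `A`. -/
structure HomIdeal (A : Type*) [Category A] [Preadditive A] where
  mor : ∀ X Y : A, AddSubgroup (X ⟶ Y)
  comp_mem : ∀ {X Y Z : A} (f : X ⟶ Y) (g : Y ⟶ Z), g ∈ mor Y Z → f ≫ g ∈ mor X Z
  mem_comp : ∀ {X Y Z : A} (f : X ⟶ Y) (g : Y ⟶ Z), f ∈ mor X Y → f ≫ g ∈ mor X Z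

/-- Two parallel morphisms are identified when their difference is in the ideal. -/
def HomIdeal.rel (I : HomIdeal A) : HomRel A := fun X Y f g => f - g ∈ I.mor X Y

instance (I : HomIdeal A) : Congruence I.rel where
  equivalence {X Y} :=
    { refl := fun f => by
        change f - f ∈ I.mor X Y
        rw [sub_self]; exact zero_mem _
      symm := fun {f g} h => by
        change g - f ∈ I.mor X Y
        rw [← neg_sub]; exact neg_mem h
      trans := fun {f g k} h h' => by
        change f - k ∈ I.mor X Y
        rw [← sub_add_sub_cancel f g k]; exact add_mem h h' }
  comp_left f _ _ h := by
    change _ - _ ∈ I.mor _ _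
    rw [← Preadditive.comp_sub]; exact I.comp_mem f _ h
  comp_right g h := by
    change _ - _ ∈ I.mor _ _
    rw [← Preadditive.sub_comp]; exact I.mem_comp _ g h

/-- The quotient category `A / I`. -/
abbrev HomIdeal.QuotCat (I : HomIdeal A) := CategoryTheory.Quotient I.rel

theorem HomIdeal.rel_add (I : HomIdeal A) ⦃X Y : A⦄ (f₁ f₂ g₁ g₂ : X ⟶ Y)
    (hf : I.rel f₁ f₂) (hg : I.rel g₁ g₂) : I.rel (f₁ + g₁) (f₂ + g₂) := by
  change _ - _ ∈ I.mor X Y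
  rw [add_sub_add_comm]; exact add_mem hf hg

instance (I : HomIdeal A) : Preadditive I.QuotCat :=
  CategoryTheory.Quotient.preadditive I.rel I.rel_add

instance (I : HomIdeal A) : (CategoryTheory.Quotient.functor I.rel).Additive :=
  CategoryTheory.Quotient.functor_additive I.rel I.rel_add

instance [HasFiniteBiproducts A] (I : HomIdeal A) : HasFiniteBiproducts I.QuotCat where
  out n := ⟨fun f => by
    have h := HasBiproduct.mk (F := (CategoryTheory.Quotient.functor I.rel).obj ∘ fun j => (f j).as)
      ⟨_, isBilimitOfPreserves (CategoryTheory.Quotient.functor I.rel)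
        (biproduct.isBilimit fun j => (f j).as)⟩
    exact h⟩

/-- `[𝒳]`: the ideal generated by the morphisms that factor through an object of `𝒳`.  When `𝒳` is
closed under finite biproducts, it consists exactly of the morphisms that factor through an object
of `𝒳`, see `mem_factorIdeal_iff`. -/
def factorIdeal (𝒳 : ObjectProperty A) : HomIdeal A where
  mor X Y := AddSubgroup.closure {f | ∃ (Z : A) (g : X ⟶ Z) (h : Z ⟶ Y), 𝒳 Z ∧ g ≫ h = f}
  comp_mem {X Y Z} f g hg := by
    induction hg using AddSubgroup.closure_induction with
    | mem g hg =>
      obtain ⟨W, a, b, hW, rfl⟩ := hg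
      exact AddSubgroup.subset_closure ⟨W, f ≫ a, b, hW, by simp⟩
    | zero => rw [comp_zero]; exact zero_mem _
    | add a b _ _ ha hb => rw [Preadditive.comp_add]; exact add_mem ha hb
    | neg a _ ha => rw [Preadditive.comp_neg]; exact neg_mem ha
  mem_comp {X Y Z} f g hf := by
    induction hf using AddSubgroup.closure_induction with
    | mem f hf =>
      obtain ⟨W, a, b, hW, rfl⟩ := hf
      exact AddSubgroup.subset_closure ⟨W, a, b ≫ g, hW, by simp⟩
    | zero => rw [zero_comp]; exact zero_mem _
    | add a b _ _ ha hb => rw [Preadditive.add_comp]; exact add_mem ha hb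
    | neg a _ ha => rw [Preadditive.neg_comp]; exact neg_mem ha

theorem mem_factorIdeal_iff [HasBinaryBiproducts A] (𝒳 : ObjectProperty A)
    (hne : ∃ Z, 𝒳 Z) (hsum : ∀ Z W, 𝒳 Z → 𝒳 W → 𝒳 (Z ⊞ W)) {X Y : A} (f : X ⟶ Y) :
    f ∈ (factorIdeal 𝒳).mor X Y ↔ ∃ (Z : A) (g : X ⟶ Z) (h : Z ⟶ Y), 𝒳 Z ∧ g ≫ h = f := by
  refine ⟨fun hf => ?_, fun hf => AddSubgroup.subset_closure hf⟩
  induction hf using AddSubgroup.closure_induction with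
  | mem f hf => exact hf
  | zero => obtain ⟨Z, hZ⟩ := hne; exact ⟨Z, 0, 0, hZ, by simp⟩
  | add a b _ _ ha hb =>
    obtain ⟨Z, g, h, hZ, rfl⟩ := ha
    obtain ⟨W, g', h', hW, rfl⟩ := hb
    exact ⟨Z ⊞ W, biprod.lift g g', biprod.desc h h', hsum _ _ hZ hW, by simp⟩
  | neg a _ ha =>
    obtain ⟨Z, g, h, hZ, rfl⟩ := ha
    exact ⟨Z, -g, h, hZ, by simp⟩

/-- The ideal of the morphisms that the additive functor `F` sends to zero. -/
def kerIdeal {B : Type*} [Category B] [Preadditive B] (F : A ⥤ B) [F.Additive] : HomIdeal A where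
  mor _ _ := F.mapAddHom.ker
  comp_mem f g (hg : F.map g = 0) := by
    change F.map (f ≫ g) = 0
    rw [F.map_comp, hg, comp_zero]
  mem_comp f g (hf : F.map f = 0) := by
    change F.map (f ≫ g) = 0
    rw [F.map_comp, hf, zero_comp]

/-- The functor on `A / I` induced by an additive functor on `A` that vanishes on `I`. -/
def HomIdeal.lift {B : Type*} [Category B] [Preadditive B] (I : HomIdeal A) (F : A ⥤ B)
    [F.Additive] (h : ∀ (X Y : A) (f : X ⟶ Y), f ∈ I.mor X Y → F.map f = 0) : I.QuotCat ⥤ B :=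
  CategoryTheory.Quotient.lift I.rel F fun X Y f g hfg => by
    have := h _ _ _ hfg
    rwa [F.map_sub, sub_eq_zero] at this

theorem HomIdeal.lift_additive {B : Type*} [Category B] [Preadditive B] (I : HomIdeal A)
    (F : A ⥤ B) [F.Additive] (h : ∀ (X Y : A) (f : X ⟶ Y), f ∈ I.mor X Y → F.map f = 0) : (I.lift F h).Additive where
  map_add {X Y f g} := by
    obtain ⟨f, rfl⟩ := (CategoryTheory.Quotient.functor I.rel).map_surjective f
    obtain ⟨g, rfl⟩ := (CategoryTheory.Quotient.functor I.rel).map_surjective g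
    rw [← Functor.map_add]
    exact F.map_add

theorem factorIdeal_le_ker {B : Type*} [Category B] [Preadditive B] (𝒳 : ObjectProperty A)
    (F : A ⥤ B) [F.Additive]
    (h : ∀ {X Y Z : A} (f : X ⟶ Z) (g : Z ⟶ Y), 𝒳 Z → F.map (f ≫ g) = 0) (X Y : A) (f : X ⟶ Y)
    (hf : f ∈ (factorIdeal 𝒳).mor X Y) : F.map f = 0 := by
  induction hf using AddSubgroup.closure_induction with
  | mem f hf => obtain ⟨Z, g, k, hZ, rfl⟩ := hf; exact h g k hZ
  | zero => simp
  | add a b _ _ ha hb => rw [F.map_add, ha, hb, add_zero]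
  | neg a _ ha => rw [F.map_neg, ha, neg_zero]

end Ideals

/-! ### Exact categories, and the category of conflations modulo the split conflations -/

section Exact

variable {M : Type*} [Category M] [Preadditive M]

/-- `i` is an admissible monomorphism (an inflation) for the class `ε`. -/
def AdmissibleMono (ε : ObjectProperty (ShortComplex M)) {X Y : M} (i : X ⟶ Y) : Prop :=
  ∃ (Z : M) (p : Y ⟶ Z) (w : i ≫ p = 0), ε (ShortComplex.mk i p w)

/-- `p` is an admissible epimorphism (a deflation) for the class `ε`. -/
def AdmissibleEpi (ε : ObjectProperty (ShortComplex M)) {Y Z : M} (p : Y ⟶ Z) : Prop :=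
  ∃ (X : M) (i : X ⟶ Y) (w : i ≫ p = 0), ε (ShortComplex.mk i p w)

/-- `ε` is an exact structure, in the sense of Quillen, on the additive category `M`. -/
structure IsExactStructure [HasFiniteBiproducts M] (ε : ObjectProperty (ShortComplex M)) :
    Prop where
  closed_iso : ∀ {S T : ShortComplex M}, (S ≅ T) → ε S → ε T
  isKernel : ∀ S, ε S → Nonempty (IsLimit (KernelFork.ofι S.f S.zero))
  isCokernel : ∀ S, ε S → Nonempty (IsColimit (CokernelCofork.ofπ S.g S.zero))
  id_mono : ∀ X : M, AdmissibleMono ε (𝟙 X)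
  id_epi : ∀ X : M, AdmissibleEpi ε (𝟙 X)
  comp_mono : ∀ {X Y Z : M} (i : X ⟶ Y) (j : Y ⟶ Z),
    AdmissibleMono ε i → AdmissibleMono ε j → AdmissibleMono ε (i ≫ j)
  comp_epi : ∀ {X Y Z : M} (p : X ⟶ Y) (q : Y ⟶ Z),
    AdmissibleEpi ε p → AdmissibleEpi ε q → AdmissibleEpi ε (p ≫ q)
  pushout : ∀ {X Y X' : M} (i : X ⟶ Y) (f : X ⟶ X'), AdmissibleMono ε i →
    ∃ (Y' : M) (f' : Y ⟶ Y') (i' : X' ⟶ Y'), IsPushout i f f' i' ∧ AdmissibleMono ε i'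
  pullback : ∀ {Y Z Z' : M} (p : Y ⟶ Z) (f : Z' ⟶ Z), AdmissibleEpi ε p →
    ∃ (Y' : M) (f' : Y' ⟶ Y) (p' : Y' ⟶ Z'), IsPullback f' p' p f ∧ AdmissibleEpi ε p'

/-- Every split epimorphism has a kernel. -/
def IsWeaklyIdempotentComplete (M : Type*) [Category M] [Preadditive M] : Prop :=
  ∀ {X Y : M} (f : X ⟶ Y), IsSplitEpi f → HasKernel f

/-- The class of the conflations of `ε` that split. -/
def splitConflations (ε : ObjectProperty (ShortComplex M)) : ObjectProperty (ShortComplex M) :=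
  fun S => ε S ∧ Nonempty S.Splitting

/-- The category of conflations of `ε`: its objects are the conflations and its morphisms are the
morphisms of complexes. -/
abbrev ConflationCat (ε : ObjectProperty (ShortComplex M)) := ε.FullSubcategory

/-- The category of conflations of `ε` modulo the ideal of the morphisms that factor through a
split conflation. -/
abbrev ConflationsModSplit (ε : ObjectProperty (ShortComplex M)) :=
  (factorIdeal ((splitConflations ε).inverseImage ε.ι : ObjectProperty (ConflationCat ε))).QuotCat

end Exact

/-! ### Extriangulated categories -/

attribute [local instance] hasBinaryBiproducts_of_finite_biproducts

/-- A sequence `A ⟶ B ⟶ C` with fixed ends `A` and `C`. -/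
structure Seq {𝒞 : Type u} [SmallCategory 𝒞] (A C : 𝒞) where
  {B : 𝒞}
  x : A ⟶ B
  y : B ⟶ C

/-- Equivalence of sequences with the same ends. -/
def seqSetoid {𝒞 : Type u} [SmallCategory 𝒞] (A C : 𝒞) : Setoid (Seq A C) where
  r s t := ∃ b : s.B ≅ t.B, s.x ≫ b.hom = t.x ∧ b.hom ≫ t.y = s.y
  iseqv :=
    { refl := fun s => ⟨Iso.refl _, by simp, by simp⟩
      symm := fun ⟨b, h₁, h₂⟩ => ⟨b.symm, by simp [← h₁], by simp [← h₂]⟩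
      trans := fun ⟨b, h₁, h₂⟩ ⟨c, h₃, h₄⟩ =>
        ⟨b ≪≫ c, by simp [← h₃, ← h₁], by simp [← h₂, ← h₄]⟩ }

/-- An additive bifunctor `E : 𝒞ᵒᵖ × 𝒞 → Ab`, together with a map `s` that sends each extension in
`E(C, A)` to an equivalence class of sequences `A ⟶ B ⟶ C`. -/
class ExtData (𝒞 : Type u) [SmallCategory 𝒞] [Preadditive 𝒞] where
  E : 𝒞ᵒᵖ ⥤ 𝒞 ⥤ AddCommGrpCat.{u}
  additive_left : E.Additive
  additive_right : ∀ X, (E.obj X).Additive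
  s : ∀ {C A : 𝒞}, (E.obj (op C)).obj A → Quotient (seqSetoid A C)

attribute [instance] ExtData.additive_left ExtData.additive_right

section Data

variable {𝒞 : Type u} [SmallCategory 𝒞] [Preadditive 𝒞] [ExtData 𝒞]

/-- The group `E(C, A)` of extensions. -/
abbrev Ex (C A : 𝒞) : Type u := ((ExtData.E (𝒞 := 𝒞)).obj (op C)).obj A

/-- `a · δ` -/
def push {C A A' : 𝒞} (a : A ⟶ A') (δ : Ex C A) : Ex C A' := (ExtData.E.obj (op C)).map a δ

/-- `δ · c` -/
def pull {C C' A : 𝒞} (c : C' ⟶ C) (δ : Ex C A) : Ex C' A := (ExtData.E.map c.op).app A δ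

/-- The sequence `A ⟶ B ⟶ C` realizes `δ`. -/
def Realizes {A B C : 𝒞} (x : A ⟶ B) (y : B ⟶ C) (δ : Ex C A) : Prop :=
  ExtData.s δ = Quotient.mk (seqSetoid A C) ⟨x, y⟩

/-- `δ ⊕ δ'`: the extension of `C ⊞ C'` by `A ⊞ A'` with components `(δ, 0, 0, δ')`. -/
def extSum [HasFiniteBiproducts 𝒞] {A C A' C' : 𝒞} (δ : Ex C A) (δ' : Ex C' A') :
    Ex (C ⊞ C') (A ⊞ A') :=
  push biprod.inl (pull biprod.fst δ) + push biprod.inr (pull biprod.snd δ')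

end Data

/-- Extriangulated categories (Nakaoka and Palu). -/
class Extriangulated (𝒞 : Type u) [SmallCategory 𝒞] [Preadditive 𝒞] [HasFiniteBiproducts 𝒞]
    extends ExtData 𝒞 where
  /-- `s` is a realization: each morphism of extensions is realized. -/
  realization : ∀ {A B C A' B' C' : 𝒞} {x : A ⟶ B} {y : B ⟶ C} {x' : A' ⟶ B'} {y' : B' ⟶ C'}
    {δ : Ex C A} {δ' : Ex C' A'}, Realizes x y δ → Realizes x' y' δ' →
    ∀ (a : A ⟶ A') (c : C ⟶ C'), push a δ = pull c δ' →
      ∃ b : B ⟶ B', x ≫ b = a ≫ x' ∧ y ≫ c = b ≫ y'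
  /-- `s` is additive. -/
  realizes_zero : ∀ A C : 𝒞,
    Realizes (biprod.inl : A ⟶ A ⊞ C) (biprod.snd : A ⊞ C ⟶ C) (0 : Ex C A)
  realizes_sum : ∀ {A B C A' B' C' : 𝒞} {x : A ⟶ B} {y : B ⟶ C} {x' : A' ⟶ B'} {y' : B' ⟶ C'}
    {δ : Ex C A} {δ' : Ex C' A'}, Realizes x y δ → Realizes x' y' δ' →
      Realizes (biprod.map x x') (biprod.map y y') (extSum δ δ')
  et3 : ∀ {A B C A' B' C' : 𝒞} {x : A ⟶ B} {y : B ⟶ C} {x' : A' ⟶ B'} {y' : B' ⟶ C'}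
    {δ : Ex C A} {δ' : Ex C' A'}, Realizes x y δ → Realizes x' y' δ' →
    ∀ (a : A ⟶ A') (b : B ⟶ B'), x ≫ b = a ≫ x' →
      ∃ c : C ⟶ C', push a δ = pull c δ' ∧ y ≫ c = b ≫ y'
  et3_op : ∀ {A B C A' B' C' : 𝒞} {x : A ⟶ B} {y : B ⟶ C} {x' : A' ⟶ B'} {y' : B' ⟶ C'}
    {δ : Ex C A} {δ' : Ex C' A'}, Realizes x y δ → Realizes x' y' δ' →
    ∀ (b : B ⟶ B') (c : C ⟶ C'), y ≫ c = b ≫ y' →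
      ∃ a : A ⟶ A', push a δ = pull c δ' ∧ x ≫ b = a ≫ x'
  et4 : ∀ {A B C D F : 𝒞} {f : A ⟶ B} {f' : B ⟶ D} {g : B ⟶ C} {g' : C ⟶ F}
    {δ : Ex D A} {δ' : Ex F B}, Realizes f f' δ → Realizes g g' δ' →
      ∃ (G : 𝒞) (d : D ⟶ G) (e : G ⟶ F) (h : A ⟶ C) (h' : C ⟶ G) (δ'' : Ex G A),
        h = f ≫ g ∧ f' ≫ d = g ≫ h' ∧ h' ≫ e = g' ∧
        Realizes h h' δ'' ∧ Realizes d e (push f' δ') ∧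
        pull d δ'' = δ ∧ push f δ'' = pull e δ'
  et4_op : ∀ {A B C D F : 𝒞} {f' : D ⟶ A} {f : A ⟶ B} {g' : F ⟶ B} {g : B ⟶ C}
    {δ : Ex B D} {δ' : Ex C F}, Realizes f' f δ → Realizes g' g δ' →
      ∃ (G : 𝒞) (d : D ⟶ G) (e : G ⟶ F) (h' : G ⟶ A) (h : A ⟶ C) (δ'' : Ex C G),
        h = f ≫ g ∧ d ≫ h' = f' ∧ h' ≫ f = e ≫ g' ∧
        Realizes h' h δ'' ∧ Realizes d e (pull g' δ) ∧
        δ' = push e δ'' ∧ push d δ = pull g δ''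

section Extri

variable {𝒞 : Type u} [SmallCategory 𝒞] [Preadditive 𝒞] [HasFiniteBiproducts 𝒞]
  [Extriangulated 𝒞]

/-- `A ⟶ B ⟶ C` is a conflation. -/
def Conflation {A B C : 𝒞} (x : A ⟶ B) (y : B ⟶ C) : Prop := ∃ δ : Ex C A, Realizes x y δ

/-- `E`-projective objects. -/
def EProjective (P : 𝒞) : Prop :=
  ∀ {A B C : 𝒞} (x : A ⟶ B) (y : B ⟶ C), Conflation x y →
    ∀ f : P ⟶ C, ∃ g : P ⟶ B, g ≫ y = f

/-- `E`-injective objects. -/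
def EInjective (I : 𝒞) : Prop :=
  ∀ {A B C : 𝒞} (x : A ⟶ B) (y : B ⟶ C), Conflation x y →
    ∀ f : A ⟶ I, ∃ g : B ⟶ I, x ≫ g = f

variable (𝒞) in
class EnoughEProjectives : Prop where
  out : ∀ C : 𝒞, ∃ (K P : 𝒞) (x : K ⟶ P) (y : P ⟶ C), EProjective P ∧ Conflation x y

variable (𝒞) in
class EnoughEInjectives : Prop where
  out : ∀ A : 𝒞, ∃ (I L : 𝒞) (x : A ⟶ I) (y : I ⟶ L), EInjective I ∧ Conflation x y

/-! ### Higher extensions, rigid and cluster tilting subcategories -/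

/-- A chosen cosyzygy `Σ Y`: there is a conflation `Y ⟶ I ⟶ Σ Y` with `I` an `E`-injective. -/
def cosyzygy [EnoughEInjectives 𝒞] (Y : 𝒞) : 𝒞 :=
  (EnoughEInjectives.out Y).choose_spec.choose

/-- `higherE i X Y` is the higher extension group `E^{i+1}(X, Y) = E(X, Σ^i Y)`; in particular
`higherE 0 X Y = E(X, Y)`. -/
def higherE [EnoughEInjectives 𝒞] (i : ℕ) (X Y : 𝒞) : Type u := Ex X (cosyzygy^[i] Y)

/-- `𝒳` is `(n+2)`-rigid: `E^k(𝒳, 𝒳) = 0` for `1 ≤ k ≤ n + 1`. -/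
def IsRigid [EnoughEInjectives 𝒞] (n : ℕ) (𝒳 : ObjectProperty 𝒞) : Prop :=
  ∀ i ≤ n, ∀ X Y : 𝒞, 𝒳 X → 𝒳 Y → Subsingleton (higherE i X Y)

/-- Each object `C` has a conflation `K ⟶ X ⟶ C` whose deflation is an `𝒳`-precover. -/
def StronglyPrecovering (𝒳 : ObjectProperty 𝒞) : Prop :=
  ∀ C : 𝒞, ∃ (K X : 𝒞) (x : K ⟶ X) (g : X ⟶ C), 𝒳 X ∧ Conflation x g ∧
    ∀ (X' : 𝒞), 𝒳 X' → ∀ f : X' ⟶ C, ∃ f' : X' ⟶ X, f' ≫ g = f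

/-- Each object `C` has a conflation `C ⟶ X ⟶ L` whose inflation is an `𝒳`-preenvelope. -/
def StronglyPreenveloping (𝒳 : ObjectProperty 𝒞) : Prop :=
  ∀ C : 𝒞, ∃ (X L : 𝒞) (g : C ⟶ X) (y : X ⟶ L), 𝒳 X ∧ Conflation g y ∧
    ∀ (X' : 𝒞), 𝒳 X' → ∀ f : C ⟶ X', ∃ f' : X ⟶ X', g ≫ f' = f

/-- `𝒳` is an `(n+2)`-cluster tilting subcategory: it is strongly precovering and strongly
preenveloping, and it is equal to the class of all `Y` with `E^k(𝒳, Y) = 0` for `1 ≤ k ≤ n + 1`,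
and to the class of all `Y` with `E^k(Y, 𝒳) = 0` for `1 ≤ k ≤ n + 1`. -/
structure IsClusterTilting [EnoughEInjectives 𝒞] (n : ℕ) (𝒳 : ObjectProperty 𝒞) : Prop where
  precovering : StronglyPrecovering 𝒳
  preenveloping : StronglyPreenveloping 𝒳
  right_perp : ∀ Y, 𝒳 Y ↔ ∀ i ≤ n, ∀ X, 𝒳 X → Subsingleton (higherE i X Y)
  left_perp : ∀ Y, 𝒳 Y ↔ ∀ i ≤ n, ∀ X, 𝒳 X → Subsingleton (higherE i Y X)

theorem IsClusterTilting.isRigid [EnoughEInjectives 𝒞] {n : ℕ} {𝒳 : ObjectProperty 𝒞}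
    (h : IsClusterTilting n 𝒳) : IsRigid n 𝒳 :=
  fun i hi X Y hX hY => (h.right_perp Y).1 hY i hi X hX

/-- `C` has an `𝒳`-coresolution of length `m`. -/
def HasCoresolution (𝒳 : ObjectProperty 𝒞) : ℕ → ObjectProperty 𝒞
  | 0 => fun C => ∃ X, 𝒳 X ∧ Nonempty (C ≅ X)
  | m + 1 => fun C => ∃ (X N : 𝒞) (x : C ⟶ X) (y : X ⟶ N), 𝒳 X ∧ HasCoresolution 𝒳 m N ∧
      Conflation x y

/-- `C` has an `𝒳`-resolution of length `m`. -/
def HasResolution (𝒳 : ObjectProperty 𝒞) : ℕ → ObjectProperty 𝒞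
  | 0 => fun C => ∃ X, 𝒳 X ∧ Nonempty (C ≅ X)
  | m + 1 => fun C => ∃ (K X : 𝒞) (x : K ⟶ X) (y : X ⟶ C), 𝒳 X ∧ HasResolution 𝒳 m K ∧
      Conflation x y

/-- `𝒳_n^∨`: the objects of `𝒳`-coresolution dimension at most `n`. -/
def vee (𝒳 : ObjectProperty 𝒞) (n : ℕ) : ObjectProperty 𝒞 := fun C => ∃ m ≤ n, HasCoresolution 𝒳 m C

/-- `𝒳_n^∧`: the objects of `𝒳`-resolution dimension at most `n`. -/
def wedge (𝒳 : ObjectProperty 𝒞) (n : ℕ) : ObjectProperty 𝒞 := fun C => ∃ m ≤ n, HasResolution 𝒳 m C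

/-! ### The vanishing facts on which the functors `F` and `K` on the quotient category rest -/

theorem pull_push {A A' C C' : 𝒞} (a : A ⟶ A') (c : C' ⟶ C) (δ : Ex C A) :
    pull c (push a δ) = push a (pull c δ) :=
  ConcreteCategory.congr_hom ((ExtData.E.map c.op).naturality a) δ

theorem pull_comp {A C C' C'' : 𝒞} (c : C' ⟶ C) (c' : C'' ⟶ C') (δ : Ex C A) :
    pull (c' ≫ c) δ = pull c' (pull c δ) := by
  simp [pull]

theorem push_comp {A A' A'' C : 𝒞} (a : A ⟶ A') (a' : A' ⟶ A'') (δ : Ex C A) :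
    push (a ≫ a') δ = push a' (push a δ) := by
  simp [push]

theorem push_id {A C : 𝒞} (δ : Ex C A) : push (𝟙 A) δ = δ := by simp [push]

theorem pull_id {A C : 𝒞} (δ : Ex C A) : pull (𝟙 C) δ = δ := by simp [pull]

theorem push_zero {A A' C : 𝒞} (a : A ⟶ A') : push a (0 : Ex C A) = 0 := map_zero _

theorem pull_zero {A C C' : 𝒞} (c : C' ⟶ C) : pull c (0 : Ex C A) = 0 := map_zero _

theorem push_comp_eq_zero {A B W Z : 𝒞} (f : A ⟶ Z) (g : Z ⟶ B) (h : Subsingleton (Ex W Z))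
    (δ : Ex W A) : push (f ≫ g) δ = 0 := by
  rw [push_comp, Subsingleton.elim (push f δ) 0, push_zero]

theorem pull_comp_eq_zero {A B W Z : 𝒞} (f : A ⟶ Z) (g : Z ⟶ B) (h : Subsingleton (Ex Z W))
    (δ : Ex B W) : pull (f ≫ g) δ = 0 := by
  rw [pull_comp, Subsingleton.elim (pull g δ) 0, pull_zero]

theorem exists_realizes {A C : 𝒞} (δ : Ex C A) :
    ∃ (B : 𝒞) (x : A ⟶ B) (y : B ⟶ C), Realizes x y δ := by
  obtain ⟨⟨x, y⟩, h⟩ := Quotient.exists_rep (ExtData.s δ)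
  exact ⟨_, x, y, h.symm⟩

/-- A morphism `f : A ⟶ W` with `f · δ = 0` extends along the inflation of `δ`. -/
theorem exists_ext {A B C W : 𝒞} {x : A ⟶ B} {y : B ⟶ C} {δ : Ex C A} (h : Realizes x y δ)
    (f : A ⟶ W) (hf : push f δ = 0) : ∃ g : B ⟶ W, x ≫ g = f := by
  obtain ⟨b, hb, -⟩ := Extriangulated.realization h (Extriangulated.realizes_zero W C) f (𝟙 C)
    (by rw [hf, pull_id])
  exact ⟨b ≫ biprod.fst, by rw [← Category.assoc, hb]; simp⟩

/-- A morphism `f : W ⟶ C` with `δ · f = 0` lifts along the deflation of `δ`. -/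
theorem exists_lift {A B C W : 𝒞} {x : A ⟶ B} {y : B ⟶ C} {δ : Ex C A} (h : Realizes x y δ)
    (f : W ⟶ C) (hf : pull f δ = 0) : ∃ g : W ⟶ B, g ≫ y = f := by
  obtain ⟨b, -, hb⟩ := Extriangulated.realization (Extriangulated.realizes_zero A W) h (𝟙 A) f
    (by rw [hf, push_zero])
  exact ⟨biprod.inr ≫ b, by rw [Category.assoc, ← hb]; simp⟩

theorem exists_pull {A B C W : 𝒞} {x : A ⟶ B} {y : B ⟶ C} {δ : Ex C A} (h : Realizes x y δ)
    (η : Ex W A) (hη : push x η = 0) : ∃ f : W ⟶ C, η = pull f δ := by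
  obtain ⟨D, e, p, hr⟩ := exists_realizes η
  obtain ⟨g, hg⟩ := exists_ext hr x hη
  obtain ⟨c, hc, -⟩ := Extriangulated.et3 hr h (𝟙 A) g (by simpa using hg)
  exact ⟨c, by rw [← hc, push_id]⟩

theorem exists_push {A B C W : 𝒞} {x : A ⟶ B} {y : B ⟶ C} {δ : Ex C A} (h : Realizes x y δ)
    (η : Ex C W) (hη : pull y η = 0) : ∃ f : A ⟶ W, η = push f δ := by
  obtain ⟨D, e, p, hr⟩ := exists_realizes η
  obtain ⟨g, hg⟩ := exists_lift hr y hη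
  obtain ⟨a, ha, -⟩ := Extriangulated.et3_op h hr g (𝟙 C) (by simpa using hg.symm)
  exact ⟨a, by rw [ha, pull_id]⟩

theorem push_inflation {A B C : 𝒞} {x : A ⟶ B} {y : B ⟶ C} {δ : Ex C A} (h : Realizes x y δ) :
    push x δ = 0 := by
  obtain ⟨c, hc, -⟩ := Extriangulated.et3 h (Extriangulated.realizes_zero B C) x biprod.inl rfl
  rw [hc, pull_zero]

theorem pull_deflation {A B C : 𝒞} {x : A ⟶ B} {y : B ⟶ C} {δ : Ex C A} (h : Realizes x y δ) :
    pull y δ = 0 := by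
  obtain ⟨a, ha, -⟩ := Extriangulated.et3_op (Extriangulated.realizes_zero A B) h biprod.snd y rfl
  rw [← ha, push_zero]

theorem EInjective.ex_eq_zero {I : 𝒞} (hI : EInjective I) {A : 𝒞} (η : Ex A I) : η = 0 := by
  obtain ⟨B, x, y, h⟩ := exists_realizes η
  obtain ⟨r, hr⟩ := hI x y ⟨η, h⟩ (𝟙 I)
  rw [← push_id η, ← hr, push_comp, push_inflation h, push_zero]

theorem EProjective.ex_eq_zero {P : 𝒞} (hP : EProjective P) {A : 𝒞} (η : Ex P A) : η = 0 := by
  obtain ⟨B, x, y, h⟩ := exists_realizes η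
  obtain ⟨r, hr⟩ := hP x y ⟨η, h⟩ (𝟙 P)
  rw [← pull_id η, ← hr, pull_comp, pull_deflation h, pull_zero]

/-- A chosen syzygy `Ω X`: there is a conflation `Ω X ⟶ P ⟶ X` with `P` an `E`-projective. -/
def syzygy [EnoughEProjectives 𝒞] (X : 𝒞) : 𝒞 := (EnoughEProjectives.out X).choose

theorem syzygy_spec [EnoughEProjectives 𝒞] (X : 𝒞) :
    ∃ (P : 𝒞) (x : syzygy X ⟶ P) (y : P ⟶ X), EProjective P ∧ Conflation x y :=
  (EnoughEProjectives.out X).choose_spec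

theorem cosyzygy_spec [EnoughEInjectives 𝒞] (Y : 𝒞) :
    ∃ (I : 𝒞) (x : Y ⟶ I) (y : I ⟶ cosyzygy Y), EInjective I ∧ Conflation x y :=
  ⟨_, (EnoughEInjectives.out Y).choose_spec.choose_spec⟩

theorem subsingleton_of_forall_eq_zero {A B : 𝒞} (h : ∀ η : Ex A B, η = 0) :
    Subsingleton (Ex A B) := ⟨fun a b => by rw [h a, h b]⟩

theorem subsingleton_syzygy_iff [EnoughEProjectives 𝒞] [EnoughEInjectives 𝒞] (X Y : 𝒞) :
    Subsingleton (Ex (syzygy X) Y) ↔ Subsingleton (Ex X (cosyzygy Y)) := by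
  obtain ⟨P, x, y, hP, θ, hθ⟩ := syzygy_spec X
  obtain ⟨I, u, v, hI, δ, hδ⟩ := cosyzygy_spec Y
  constructor <;> intro hs <;> refine subsingleton_of_forall_eq_zero fun η => ?_
  · obtain ⟨f, rfl⟩ := exists_push hθ η (hP.ex_eq_zero _)
    obtain ⟨g, rfl⟩ := exists_lift hδ f (Subsingleton.elim _ _)
    rw [push_comp, hI.ex_eq_zero (push g θ), push_zero]
  · obtain ⟨f, rfl⟩ := exists_pull hδ η (hI.ex_eq_zero _)
    obtain ⟨g, rfl⟩ := exists_ext hθ f (Subsingleton.elim _ _)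
    rw [pull_comp, hP.ex_eq_zero (pull g δ), pull_zero]

theorem subsingleton_syzygy_iterate_iff [EnoughEProjectives 𝒞] [EnoughEInjectives 𝒞] (i : ℕ)
    (X Y : 𝒞) : Subsingleton (Ex (syzygy^[i] X) Y) ↔ Subsingleton (higherE i X Y) := by
  unfold higherE
  induction i generalizing Y with
  | zero => rfl
  | succ i ih =>
    rw [Function.iterate_succ_apply', subsingleton_syzygy_iff, ih, Function.iterate_succ_apply]

theorem subsingleton_ex_of_iso {A A' B B' : 𝒞} (e : A ≅ A') (f : B ≅ B')
    (h : Subsingleton (Ex A' B')) : Subsingleton (Ex A B) := by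
  refine subsingleton_of_forall_eq_zero fun η => ?_
  have h0 : pull e.inv (push f.hom η) = 0 := Subsingleton.elim _ _
  have h1 : pull e.hom (pull e.inv (push f.hom η)) = 0 := by rw [h0, pull_zero]
  rw [← pull_comp, e.hom_inv_id, pull_id] at h1
  rw [← push_id η, ← f.hom_inv_id, push_comp, h1, push_zero]

theorem IsRigid.coresolution [EnoughEInjectives 𝒞] {n : ℕ} {𝒳 : ObjectProperty 𝒞}
    (h : IsRigid n 𝒳) (m : ℕ) : ∀ (i : ℕ), m + i ≤ n → ∀ M Y : 𝒞, HasCoresolution 𝒳 m M → 𝒳 Y →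
      Subsingleton (higherE i M Y) := by
  induction m with
  | zero =>
    rintro i hi M Y ⟨X, hX, ⟨e⟩⟩ hY
    exact subsingleton_ex_of_iso e (Iso.refl _) (h i (by omega) X Y hX hY)
  | succ m ih =>
    rintro i hi M Y ⟨X, N, x, y, hX, hN, θ, hθ⟩ hY
    obtain ⟨I, u, v, hI, δ, hδ⟩ := cosyzygy_spec (cosyzygy^[i] Y)
    refine subsingleton_of_forall_eq_zero fun η => ?_
    obtain ⟨f, rfl⟩ := exists_pull hδ η (hI.ex_eq_zero _)
    have h1 := ih (i + 1) (by omega) N Y hN hY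
    have h2 := h i (by omega) X Y hX hY
    unfold higherE at h1 h2
    rw [Function.iterate_succ_apply'] at h1
    obtain ⟨g, rfl⟩ := exists_ext hθ f (Subsingleton.elim _ _)
    rw [pull_comp, Subsingleton.elim (pull g δ) 0, pull_zero]

theorem IsRigid.resolution [EnoughEProjectives 𝒞] [EnoughEInjectives 𝒞] {n : ℕ}
    {𝒳 : ObjectProperty 𝒞} (h : IsRigid n 𝒳) (m : ℕ) : ∀ (i : ℕ), m + i ≤ n → ∀ M Y : 𝒞,
      HasResolution 𝒳 m M → 𝒳 Y → Subsingleton (Ex (syzygy^[i] Y) M) := by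
  induction m with
  | zero =>
    rintro i hi M Y ⟨X, hX, ⟨e⟩⟩ hY
    exact subsingleton_ex_of_iso (Iso.refl _) e
      ((subsingleton_syzygy_iterate_iff i Y X).2 (h i (by omega) Y X hY hX))
  | succ m ih =>
    rintro i hi M Y ⟨K, X, x, y, hX, hK, θ, hθ⟩ hY
    obtain ⟨P, u, v, hP, δ, hδ⟩ := syzygy_spec (syzygy^[i] Y)
    refine subsingleton_of_forall_eq_zero fun η => ?_
    obtain ⟨f, rfl⟩ := exists_push hδ η (hP.ex_eq_zero _)
    have h1 := ih (i + 1) (by omega) K Y hK hY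
    have h2 := (subsingleton_syzygy_iterate_iff i Y X).2 (h i (by omega) Y X hY hX)
    rw [Function.iterate_succ_apply'] at h1
    obtain ⟨g, rfl⟩ := exists_lift hθ f (Subsingleton.elim _ _)
    rw [push_comp, Subsingleton.elim (push g δ) 0, push_zero]

/-- `E(𝒳_n^∨, 𝒳) = 0`. -/
theorem IsRigid.vee_left [EnoughEInjectives 𝒞] {n : ℕ} {𝒳 : ObjectProperty 𝒞}
    (h : IsRigid n 𝒳) {M Y : 𝒞} (hM : vee 𝒳 n M) (hY : 𝒳 Y) : Subsingleton (Ex M Y) := by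
  obtain ⟨m, hm, hM⟩ := hM
  exact h.coresolution m 0 hm M Y hM hY

/-- `E(𝒳, 𝒳_n^∧) = 0`. -/
theorem IsRigid.wedge_right [EnoughEProjectives 𝒞] [EnoughEInjectives 𝒞] {n : ℕ}
    {𝒳 : ObjectProperty 𝒞} (h : IsRigid n 𝒳) {M Y : 𝒞} (hM : wedge 𝒳 n M) (hY : 𝒳 Y) :
    Subsingleton (Ex Y M) := by
  obtain ⟨m, hm, hM⟩ := hM
  exact h.resolution m 0 hm M Y hM hY

/-! ### The functors `F` and `K` and the exact structures that they induce -/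

instance : (ExtData.E (𝒞 := 𝒞)).flip.Additive where
  map_add {X Y f g} := by
    ext Z δ
    exact ConcreteCategory.congr_hom ((ExtData.E.obj Z).map_add (f := f) (g := g)) δ

/-- The ideal of the `E`-projective morphisms of the full subcategory `𝒴`: the morphisms `f` with
`E(f, -) = 0`. -/
def projIdeal (𝒴 : ObjectProperty 𝒞) : HomIdeal 𝒴.FullSubcategory :=
  kerIdeal (𝒴.ι ⋙ ExtData.E.rightOp)

/-- The ideal of the `E`-injective morphisms of the full subcategory `𝒴`: the morphisms `f` with
`E(-, f) = 0`. -/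
def injIdeal (𝒴 : ObjectProperty 𝒞) : HomIdeal 𝒴.FullSubcategory :=
  kerIdeal (𝒴.ι ⋙ ExtData.E.flip)

/-- The stable category of `𝒴`. -/
abbrev Stable (𝒴 : ObjectProperty 𝒞) := (projIdeal 𝒴).QuotCat

/-- The costable category of `𝒴`. -/
abbrev Costable (𝒴 : ObjectProperty 𝒞) := (injIdeal 𝒴).QuotCat

/-- `M ↦ E(-, M)`, restricted to the full subcategory `𝒴` and seen on its stable category. -/
def functorH (𝒴 : ObjectProperty 𝒞) : 𝒞 ⥤ (Stable 𝒴)ᵒᵖ ⥤ AddCommGrpCat.{u} :=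
  ((projIdeal 𝒴).lift (𝒴.ι ⋙ ExtData.E.rightOp) fun _ _ _ h => h).leftOp.flip

/-- `M ↦ E(M, -)`, restricted to the full subcategory `𝒴` and seen on its costable category. -/
def functorG (𝒴 : ObjectProperty 𝒞) : 𝒞ᵒᵖ ⥤ Costable 𝒴 ⥤ AddCommGrpCat.{u} :=
  ((injIdeal 𝒴).lift (𝒴.ι ⋙ ExtData.E.flip) fun _ _ _ h => h).flip

instance (𝒴 : ObjectProperty 𝒞) : (functorH 𝒴).Additive where
  map_add {X Y f g} := by
    ext Z δ
    exact ConcreteCategory.congr_hom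
      ((ExtData.E.obj (op ((unop Z).as.obj))).map_add (f := f) (g := g)) δ

instance (𝒴 : ObjectProperty 𝒞) : (functorG 𝒴).Additive where
  map_add {X Y f g} := by
    ext Z δ
    have h : ExtData.E.map (f + g) = ExtData.E.map f + ExtData.E.map g := Functor.map_add _
    exact ConcreteCategory.congr_hom (NatTrans.congr_app h Z.as.obj) δ

/-- The quotient category `𝒞 / [𝒳]`. -/
abbrev QuotBy (𝒳 : ObjectProperty 𝒞) := (factorIdeal 𝒳).QuotCat

theorem functorH_map_eq_zero [EnoughEInjectives 𝒞] {n : ℕ} {𝒳 : ObjectProperty 𝒞}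
    (h : IsRigid n 𝒳) : ∀ (A B : 𝒞) (f : A ⟶ B), f ∈ (factorIdeal 𝒳).mor A B →
      (functorH (vee 𝒳 n)).map f = 0 :=
  factorIdeal_le_ker _ _ fun {A B Z} f g hZ => by
    ext W δ
    exact push_comp_eq_zero f g (h.vee_left (unop W).as.property hZ) δ

theorem functorG_map_eq_zero [EnoughEProjectives 𝒞] [EnoughEInjectives 𝒞] {n : ℕ}
    {𝒳 : ObjectProperty 𝒞} (h : IsRigid n 𝒳) : ∀ (A B : 𝒞) (f : A ⟶ B),
      f ∈ (factorIdeal 𝒳).mor A B → (functorG (wedge 𝒳 n)).rightOp.map f = 0 :=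
  factorIdeal_le_ker _ _ fun {A B Z} f g hZ => by
    apply Quiver.Hom.unop_inj
    ext W δ
    exact pull_comp_eq_zero f g (h.wedge_right W.as.property hZ) δ

/-- The functor `F` on `𝒞 / [𝒳]`, which sends `M` to the right module `E(-, M)` over the stable
category of `𝒳_n^∨`. -/
def functorF [EnoughEInjectives 𝒞] (n : ℕ) (𝒳 : ObjectProperty 𝒞) (h : IsRigid n 𝒳) :
    QuotBy 𝒳 ⥤ (Stable (vee 𝒳 n))ᵒᵖ ⥤ AddCommGrpCat.{u} :=
  (factorIdeal 𝒳).lift (functorH (vee 𝒳 n)) (functorH_map_eq_zero h)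

/-- The contravariant functor `K` on `𝒞 / [𝒳]`, which sends `M` to the left module `E(M, -)` over
the costable category of `𝒳_n^∧`. -/
def functorK [EnoughEProjectives 𝒞] [EnoughEInjectives 𝒞] (n : ℕ) (𝒳 : ObjectProperty 𝒞)
    (h : IsRigid n 𝒳) : (QuotBy 𝒳)ᵒᵖ ⥤ Costable (wedge 𝒳 n) ⥤ AddCommGrpCat.{u} :=
  ((factorIdeal 𝒳).lift (functorG (wedge 𝒳 n)).rightOp (functorG_map_eq_zero h)).leftOp

instance [EnoughEInjectives 𝒞] (n : ℕ) (𝒳 : ObjectProperty 𝒞) (h : IsRigid n 𝒳) :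
    (functorF n 𝒳 h).Additive :=
  HomIdeal.lift_additive _ _ (functorH_map_eq_zero h)

instance [EnoughEProjectives 𝒞] [EnoughEInjectives 𝒞] (n : ℕ) (𝒳 : ObjectProperty 𝒞)
    (h : IsRigid n 𝒳) : (functorK n 𝒳 h).Additive := by
  have := HomIdeal.lift_additive (factorIdeal 𝒳) _ (functorG_map_eq_zero h)
  unfold functorK
  infer_instance

instance [EnoughEInjectives 𝒞] (n : ℕ) (𝒳 : ObjectProperty 𝒞) (h : IsRigid n 𝒳)
    (M : QuotBy 𝒳) : ((functorF n 𝒳 h).obj M).Additive where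
  map_add {X Y f g} := by
    have hadd := HomIdeal.lift_additive (projIdeal (vee 𝒳 n)) ((vee 𝒳 n).ι ⋙ ExtData.E.rightOp)
      fun _ _ _ h => h
    have := congrArg Quiver.Hom.unop (hadd.map_add (f := f.unop) (g := g.unop))
    exact NatTrans.congr_app this M.as

instance [EnoughEProjectives 𝒞] [EnoughEInjectives 𝒞] (n : ℕ) (𝒳 : ObjectProperty 𝒞)
    (h : IsRigid n 𝒳) (M : (QuotBy 𝒳)ᵒᵖ) : ((functorK n 𝒳 h).obj M).Additive where
  map_add {X Y f g} := by
    have hadd := HomIdeal.lift_additive (injIdeal (wedge 𝒳 n)) ((wedge 𝒳 n).ι ⋙ ExtData.E.flip)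
      fun _ _ _ h => h
    exact NatTrans.congr_app (hadd.map_add (f := f) (g := g)) (op (unop M).as)

/-- The class `ε_F` of the sequences `A' ⟶ A ⟶ A''` in `𝒞 / [𝒳]` for which
`0 ⟶ F(A') ⟶ F(A) ⟶ F(A'') ⟶ 0` is exact.  Exactness of a sequence of modules over the stable
category is exactness at each object, which is exactness in the category of all functors. -/
def epsF [EnoughEInjectives 𝒞] (n : ℕ) (𝒳 : ObjectProperty 𝒞) (h : IsRigid n 𝒳) :
    ObjectProperty (ShortComplex (QuotBy 𝒳)) :=
  fun S => (S.map (functorF n 𝒳 h)).ShortExact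

/-- The class `ε_K` of the sequences `A' ⟶ A ⟶ A''` in `𝒞 / [𝒳]` for which
`0 ⟶ K(A'') ⟶ K(A) ⟶ K(A') ⟶ 0` is exact. -/
def epsK [EnoughEProjectives 𝒞] [EnoughEInjectives 𝒞] (n : ℕ) (𝒳 : ObjectProperty 𝒞)
    (h : IsRigid n 𝒳) : ObjectProperty (ShortComplex (QuotBy 𝒳)) :=
  fun S => (S.op.map (functorK n 𝒳 h)).ShortExact

end Extri

end

end ExtriCat

/-!
The quotient `𝒞 / [𝒳]` is identified, by means of each of the functors `F` and `K`, with an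
extension-closed full subcategory of an abelian category; it inherits from there an exact structure,
and the conflations of any exact category modulo the split ones form an abelian category.

*Embedding.* By dimension shifting, `𝒳_n^∨` is the class of all `V` with `E(V, 𝒳) = 0`
(`IsClusterTilting.vee_iff`), so the cokernel `L` of an `𝒳`-preenvelope `M ⟶ X` lies in `𝒳_n^∨`.
As `E(-, X)` vanishes on `𝒳_n^∨`, the class `δ` in `E(L, M)` of the conflation `M ⟶ X ⟶ L` generates
the module `F(M)`, with relations given by `X ⟶ L`: the module is presented by a deflation from an
object of `𝒳` to an object of `𝒳_n^∨` (`IsClusterTilting.isPresentedBy_functorF`), and conversely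
each such deflation presents `F` of its kernel. A morphism `M ⟶ N` that kills `δ` extends to `X`, so
`F` is faithful on `𝒞 / [𝒳]`; a morphism `F(M) ⟶ F(N)` is determined by the image of `δ`, which is
the pushout of `δ` along some `M ⟶ N`, so `F` is full. An extension of `F(M'')` by `F(M')` is
presented by a triangular matrix with the two presentations on its diagonal
(`IsPresentedBy.exists_extension`); this matrix is represented by a deflation of the same kind
(`IsDeflation.triangular`), hence the extension is in the essential image of `F`. For `K` everything
is dual, with `𝒳`-precovers and `𝒳_n^∧`.

*Exact structures.* A full embedding into an abelian category whose essential image is closed under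
extensions induces an exact structure (`isExactStructure_shortExactClass`). Split sequences are
conflations for every exact structure, so that the split conflations of `ε_F` and of `ε_K` are just
the split sequences (`IsExactStructure.splitConflations_eq`). The quotient `𝒞 / [𝒳]` is weakly
idempotent complete because a split epimorphism of it becomes a split deflation of `𝒞` when a
suitable object of `𝒳` is added to its source (`IsClusterTilting.isWeaklyIdempotentComplete`).

*Conflations modulo split conflations.* A morphism `φ : S ⟶ T` of conflations vanishes in the
quotient if and only if its last component lifts along `T.g`, or equivalently its first component
extends along `S.f` (`modSplit_eq_zero_iff_lift`, `modSplit_eq_zero_iff_ext`). Hence the kernel of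
`φ` is a pullback of `S` (`exists_kernel_modSplit`) and its cokernel a pushout of `T`
(`exists_cokernel_modSplit`). The comparison of the pushout of `S` along the first component of `φ`
with `T` is the kernel of the cokernel of `φ`, and it is isomorphic to `φ` when the kernel of `φ`
vanishes; so monomorphisms are normal, and dually epimorphisms are normal.
-/

namespace ExtriCat

/-! ### The exact structure induced by an extension-closed full embedding -/

section Embedding

variable {D : Type*} [Category D] [Preadditive D] {A : Type*} [Category A] [Abelian A]
  (G : D ⥤ A) [G.Additive]

/-- The sequences that the additive functor `G` sends to short exact sequences. -/
def shortExactClass : ObjectProperty (ShortComplex D) := fun S => (S.map G).ShortExact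

theorem shortExactClass_of_splitting {S : ShortComplex D} (s : S.Splitting) :
    shortExactClass G S :=
  (s.map G).shortExact

variable [G.Full] [G.Faithful]

/-- Admissibility of a monomorphism only depends on whether its cokernel in the ambient abelian
category comes from the subcategory. -/
theorem admissibleMono_shortExactClass_iff {X Y : D} (i : X ⟶ Y) :
    AdmissibleMono (shortExactClass G) i ↔ Mono (G.map i) ∧ G.essImage (cokernel (G.map i)) := by
  constructor
  · rintro ⟨Z, p, w, h⟩
    exact ⟨h.mono_f, Z,
      ⟨h.gIsCokernel.coconePointUniqueUpToIso (colimit.isColimit (parallelPair (G.map i) 0))⟩⟩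
  · rintro ⟨h, Z, ⟨e⟩⟩
    have hp : G.map (G.preimage (cokernel.π (G.map i) ≫ e.inv)) = cokernel.π (G.map i) ≫ e.inv :=
      G.map_preimage _
    refine ⟨Z, G.preimage (cokernel.π (G.map i) ≫ e.inv), G.map_injective (by simp), ?_⟩
    refine ShortComplex.shortExact_of_iso (ShortComplex.isoMk (S₁ := ShortComplex.mk (G.map i)
      (cokernel.π (G.map i)) (by simp)) (Iso.refl _) (Iso.refl _) e.symm ?_ ?_) ?_
    · exact (Category.id_comp _).trans (Category.comp_id _).symm
    · exact (Category.id_comp _).trans hp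
    · exact { exact := ShortComplex.exact_cokernel _, mono_f := h,
              epi_g := by dsimp; infer_instance }

theorem admissibleEpi_shortExactClass_iff {Y Z : D} (p : Y ⟶ Z) :
    AdmissibleEpi (shortExactClass G) p ↔ Epi (G.map p) ∧ G.essImage (kernel (G.map p)) := by
  constructor
  · rintro ⟨X, i, w, h⟩
    exact ⟨h.epi_g, X,
      ⟨h.fIsKernel.conePointUniqueUpToIso (limit.isLimit (parallelPair (G.map p) 0))⟩⟩
  · rintro ⟨h, X, ⟨e⟩⟩
    have hp : G.map (G.preimage (e.hom ≫ kernel.ι (G.map p))) = e.hom ≫ kernel.ι (G.map p) :=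
      G.map_preimage _
    refine ⟨X, G.preimage (e.hom ≫ kernel.ι (G.map p)), G.map_injective (by simp), ?_⟩
    refine ShortComplex.shortExact_of_iso (ShortComplex.isoMk (S₁ := ShortComplex.mk
      (kernel.ι (G.map p)) (G.map p) (by simp)) e.symm (Iso.refl _) (Iso.refl _) ?_ ?_) ?_
    · exact (e.inv_hom_id_assoc _ ▸ (congrArg (e.inv ≫ ·) hp)).trans (Category.comp_id _).symm
    · exact (Category.id_comp _).trans (Category.comp_id _).symm
    · exact { exact := ShortComplex.exact_kernel _, mono_f := by dsimp; infer_instance,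
              epi_g := h }

/-- A full subcategory of an abelian category that is closed under extensions is an exact
category. -/
theorem isExactStructure_shortExactClass [HasFiniteBiproducts D]
    [G.essImage.IsClosedUnderExtensions] : IsExactStructure (shortExactClass G) where
  closed_iso e h := ShortComplex.shortExact_of_iso (G.mapShortComplex.mapIso e) h
  isKernel S h := by
    have : Mono S.f := G.mono_of_mono_map h.mono_f
    refine ⟨KernelFork.IsLimit.ofι' _ _ fun {B} k hk => Classical.choice ?_⟩
    have hk' : G.map k ≫ G.map S.g = 0 := by rw [← G.map_comp, hk, G.map_zero]
    obtain ⟨l, hl⟩ : ∃ l : G.obj B ⟶ G.obj S.X₁, l ≫ G.map S.f = G.map k :=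
      ⟨_, (KernelFork.IsLimit.lift' h.fIsKernel (G.map k) hk').2⟩
    exact ⟨G.preimage l, G.map_injective (by rw [G.map_comp, G.map_preimage, hl])⟩
  isCokernel S h := by
    have : Epi S.g := G.epi_of_epi_map h.epi_g
    refine ⟨CokernelCofork.IsColimit.ofπ' _ _ fun {B} k hk => Classical.choice ?_⟩
    have hk' : G.map S.f ≫ G.map k = 0 := by rw [← G.map_comp, hk, G.map_zero]
    obtain ⟨l, hl⟩ : ∃ l : G.obj S.X₃ ⟶ G.obj B, G.map S.g ≫ l = G.map k :=
      ⟨_, (CokernelCofork.IsColimit.desc' h.gIsCokernel (G.map k) hk').2⟩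
    exact ⟨G.preimage l, G.map_injective (by rw [G.map_comp, G.map_preimage, hl])⟩
  id_mono X := by
    obtain ⟨Z, hZ⟩ := (inferInstance : HasZeroObject D)
    exact ⟨Z, 0, by simp, shortExactClass_of_splitting G
    { r := 𝟙 X, s := 0, s_g := hZ.eq_of_src _ _ }⟩
  id_epi X := by
    obtain ⟨Z, hZ⟩ := (inferInstance : HasZeroObject D)
    exact ⟨Z, 0, by simp, shortExactClass_of_splitting G
    { r := 0, s := 𝟙 X, f_r := hZ.eq_of_src _ _ }⟩
  comp_mono i j hi hj := by
    rw [admissibleMono_shortExactClass_iff] at hi hj ⊢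
    obtain ⟨_, hi'⟩ := hi
    obtain ⟨_, hj'⟩ := hj
    rw [G.map_comp]
    refine ⟨inferInstance, ?_⟩
    have hS := kernelCokernelCompSequence_exact (G.map i) (G.map j)
    refine G.essImage.prop_X₂_of_shortExact (S := ShortComplex.mk
      (cokernel.map (G.map i) (G.map i ≫ G.map j) (𝟙 _) (G.map j) (by simp))
      (cokernel.map (G.map i ≫ G.map j) (G.map j) (G.map i) (𝟙 _) (by simp)) (by ext; simp)) ?_
      hi' hj'
    -- The connecting morphism of the kernel-cokernel sequence of the composition starts at zero.
    have h0 : kernelCokernelCompSequence.δ (G.map i) (G.map j) = 0 := by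
      rw [kernelCokernelCompSequence.δ_fac, kernel.ι_of_mono]; simp
    exact { exact := hS.exact 3, mono_f := (hS.exact 2).mono_g h0,
            epi_g := by dsimp; infer_instance }
  comp_epi p q hp hq := by
    rw [admissibleEpi_shortExactClass_iff] at hp hq ⊢
    obtain ⟨_, hp'⟩ := hp
    obtain ⟨_, hq'⟩ := hq
    rw [G.map_comp]
    refine ⟨epi_comp _ _, ?_⟩
    have hS := kernelCokernelCompSequence_exact (G.map p) (G.map q)
    refine G.essImage.prop_X₂_of_shortExact (S := ShortComplex.mk
      (kernel.map (G.map p) (G.map p ≫ G.map q) (𝟙 _) (G.map q) (by simp))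
      (kernel.map (G.map p ≫ G.map q) (G.map q) (G.map p) (𝟙 _) (by simp)) (by ext; simp)) ?_
      hp' hq'
    -- The connecting morphism of the kernel-cokernel sequence of the composition ends at zero.
    have h0 : kernelCokernelCompSequence.δ (G.map p) (G.map q) = 0 := by
      rw [kernelCokernelCompSequence.δ_fac, cokernel.π_of_epi]; simp
    exact { exact := hS.exact 0, mono_f := by dsimp; infer_instance,
            epi_g := (hS.exact 1).epi_f h0 }
  pushout {X Y X'} i f hi := by
    rw [admissibleMono_shortExactClass_iff] at hi
    obtain ⟨_, hi'⟩ := hi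
    have sq := IsPushout.of_hasPushout (G.map i) (G.map f)
    have hc := isIso_cokernel_map_of_isPushout sq
    have hc' := G.essImage.prop_of_iso (asIso (cokernel.map _ _ _ _ sq.w)) hi'
    obtain ⟨Y', ⟨e⟩⟩ := G.essImage.prop_X₂_of_shortExact (S := ShortComplex.mk _ _
      (cokernel.condition (pushout.inr (G.map i) (G.map f))))
      { exact := ShortComplex.exact_cokernel _ } ⟨_, ⟨Iso.refl _⟩⟩ hc'
    change G.obj Y' ≅ pushout (G.map i) (G.map f) at e
    have sq' := sq.of_iso (Iso.refl _) (Iso.refl _) (Iso.refl _) e.symm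
      (f' := G.map i) (g' := G.map f) (inl' := G.map (G.preimage (pushout.inl _ _ ≫ e.inv)))
      (inr' := G.map (G.preimage (pushout.inr _ _ ≫ e.inv))) (by simp) (by simp) (by simp) (by simp)
    refine ⟨Y', _, _, IsPushout.of_map G (G.map_injective (by simpa using sq'.w)) sq', ?_⟩
    have hc := isIso_cokernel_map_of_isPushout sq'
    rw [admissibleMono_shortExactClass_iff]
    refine ⟨?_, G.essImage.prop_of_iso (asIso (cokernel.map _ _ _ _ sq'.w)) hi'⟩
    rw [G.map_preimage]
    exact mono_comp _ _
  pullback {Y Z Z'} p f hp := by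
    rw [admissibleEpi_shortExactClass_iff] at hp
    obtain ⟨_, hp'⟩ := hp
    have sq := IsPullback.of_hasPullback (G.map p) (G.map f)
    have hc := isIso_kernel_map_of_isPullback sq.flip
    have hc' := G.essImage.prop_of_iso (asIso (kernel.map _ _ _ _ sq.flip.w)).symm hp'
    obtain ⟨Y', ⟨e⟩⟩ := G.essImage.prop_X₂_of_shortExact (S := ShortComplex.mk _ _
      (kernel.condition (pullback.snd (G.map p) (G.map f))))
      { exact := ShortComplex.exact_kernel _ } hc' ⟨_, ⟨Iso.refl _⟩⟩
    change G.obj Y' ≅ pullback (G.map p) (G.map f) at e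
    have sq' := sq.of_iso e.symm (Iso.refl _) (Iso.refl _) (Iso.refl _)
      (fst' := G.map (G.preimage (e.hom ≫ pullback.fst _ _)))
      (snd' := G.map (G.preimage (e.hom ≫ pullback.snd _ _)))
      (f' := G.map p) (g' := G.map f) (by simp) (by simp) (by simp) (by simp)
    refine ⟨Y', _, _, IsPullback.of_map G (G.map_injective (by simpa using sq'.w)) sq', ?_⟩
    have hc := isIso_kernel_map_of_isPullback sq'.flip
    rw [admissibleEpi_shortExactClass_iff]
    refine ⟨?_, G.essImage.prop_of_iso (asIso (kernel.map _ _ _ _ sq'.flip.w)).symm hp'⟩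
    rw [G.map_preimage]
    exact epi_comp _ _

end Embedding

attribute [local instance] hasBinaryBiproducts_of_finite_biproducts

/-! ### Conflations of an exact category -/

section ExactCategory

variable {M : Type*} [Category M] [Preadditive M] [HasFiniteBiproducts M]
  {ε : ObjectProperty (ShortComplex M)}

namespace IsExactStructure

theorem mono_f (hε : IsExactStructure ε) {S : ShortComplex M} (hS : ε S) : Mono S.f :=
  ⟨fun _ _ h => Fork.IsLimit.hom_ext (hε.isKernel S hS).some h⟩

theorem epi_g (hε : IsExactStructure ε) {S : ShortComplex M} (hS : ε S) : Epi S.g :=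
  ⟨fun _ _ h => Cofork.IsColimit.hom_ext (hε.isCokernel S hS).some h⟩

theorem exists_lift (hε : IsExactStructure ε) {S : ShortComplex M} (hS : ε S) {W : M}
    (k : W ⟶ S.X₂) (hk : k ≫ S.g = 0) : ∃ l : W ⟶ S.X₁, l ≫ S.f = k :=
  ⟨_, (KernelFork.IsLimit.lift' (hε.isKernel S hS).some k hk).2⟩

theorem exists_desc (hε : IsExactStructure ε) {S : ShortComplex M} (hS : ε S) {W : M}
    (k : S.X₂ ⟶ W) (hk : S.f ≫ k = 0) : ∃ l : S.X₃ ⟶ W, S.g ≫ l = k :=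
  ⟨_, (CokernelCofork.IsColimit.desc' (hε.isCokernel S hS).some k hk).2⟩

/-- An admissible monomorphism forms a conflation with each of its cokernels. -/
theorem of_admissibleMono (hε : IsExactStructure ε) {X Y Z : M} {i : X ⟶ Y}
    (hi : AdmissibleMono ε i) (p : Y ⟶ Z) [Epi p] (w : i ≫ p = 0)
    (h : ∀ {W : M} (k : Y ⟶ W), i ≫ k = 0 → ∃ l : Z ⟶ W, p ≫ l = k) :
    ε (ShortComplex.mk i p w) := by
  obtain ⟨Z', p', w', hS⟩ := hi
  have := hε.epi_g hS
  dsimp at this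
  obtain ⟨l, hl⟩ := h p' w'
  obtain ⟨m, hm⟩ := hε.exists_desc hS p w
  dsimp at m hm
  refine hε.closed_iso (ShortComplex.isoMk (S₁ := ShortComplex.mk i p' w')
    (Iso.refl _) (Iso.refl _) ⟨m, l, ?_, ?_⟩ ?_ ?_) hS
  · rw [← cancel_epi p', reassoc_of% hm, hl, Category.comp_id]
  · rw [← cancel_epi p, reassoc_of% hl, hm, Category.comp_id]
  · simp
  · simp [hm]

/-- An admissible epimorphism forms a conflation with each of its kernels. -/
theorem of_admissibleEpi (hε : IsExactStructure ε) {X Y Z : M} {p : Y ⟶ Z}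
    (hp : AdmissibleEpi ε p) (i : X ⟶ Y) [Mono i] (w : i ≫ p = 0)
    (h : ∀ {W : M} (k : W ⟶ Y), k ≫ p = 0 → ∃ l : W ⟶ X, l ≫ i = k) :
    ε (ShortComplex.mk i p w) := by
  obtain ⟨X', i', w', hS⟩ := hp
  have := hε.mono_f hS
  dsimp at this
  obtain ⟨l, hl⟩ := h i' w'
  obtain ⟨m, hm⟩ := hε.exists_lift hS i w
  dsimp at m hm
  refine hε.closed_iso (ShortComplex.isoMk (S₁ := ShortComplex.mk i' p w')
    ⟨l, m, ?_, ?_⟩ (Iso.refl _) (Iso.refl _) ?_ ?_) hS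
  · rw [← cancel_mono i', Category.assoc, hm, hl, Category.id_comp]
  · rw [← cancel_mono i, Category.assoc, hl, hm, Category.id_comp]
  · simp [hl]
  · simp

/-- The pushout of a conflation along a morphism from its first term. -/
theorem exists_pushout (hε : IsExactStructure ε) {S : ShortComplex M} (hS : ε S) {A : M}
    (a : S.X₁ ⟶ A) : ∃ (R : M) (j : S.X₂ ⟶ R) (i : A ⟶ R) (p : R ⟶ S.X₃) (w : i ≫ p = 0),
      IsPushout S.f a j i ∧ ε (ShortComplex.mk i p w) ∧ j ≫ p = S.g := by
  obtain ⟨R, j, i, sq, hi⟩ := hε.pushout S.f a ⟨_, _, _, hS⟩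
  have hj : j ≫ sq.desc S.g 0 (by simp) = S.g := by simp
  have : Epi S.g := hε.epi_g hS
  have : Epi (j ≫ sq.desc S.g 0 (by simp)) := by rwa [hj]
  have : Epi (sq.desc S.g 0 (by simp)) := epi_of_epi j _
  refine ⟨R, j, i, _, sq.inr_desc _ _ _, sq, hε.of_admissibleMono hi _ _ ?_, hj⟩
  intro W k hk
  obtain ⟨l, hl⟩ := hε.exists_desc hS (j ≫ k) (by rw [sq.w_assoc, hk, comp_zero])
  exact ⟨l, sq.hom_ext (by simp [hl]) (by simp [hk])⟩

/-- The pullback of a conflation along a morphism to its last term. -/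
theorem exists_pullback (hε : IsExactStructure ε) {S : ShortComplex M} (hS : ε S) {C : M}
    (c : C ⟶ S.X₃) : ∃ (P : M) (j : P ⟶ S.X₂) (p : P ⟶ C) (i : S.X₁ ⟶ P) (w : i ≫ p = 0),
      IsPullback j p S.g c ∧ ε (ShortComplex.mk i p w) ∧ i ≫ j = S.f := by
  obtain ⟨P, j, p, sq, hp⟩ := hε.pullback S.g c ⟨_, _, _, hS⟩
  have hj : sq.lift S.f 0 (by simp) ≫ j = S.f := by simp
  have : Mono S.f := hε.mono_f hS
  have : Mono (sq.lift S.f 0 (by simp) ≫ j) := by rwa [hj]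
  have : Mono (sq.lift S.f 0 (by simp)) := mono_of_mono _ j
  refine ⟨P, j, p, _, sq.lift_snd _ _ _, sq, hε.of_admissibleEpi hp _ _ ?_, hj⟩
  intro W k hk
  obtain ⟨l, hl⟩ := hε.exists_lift hS (k ≫ j)
    (by rw [Category.assoc, sq.w, reassoc_of% hk, zero_comp])
  exact ⟨l, sq.hom_ext (by simp [hl]) (by simp [hk])⟩

theorem admissibleMono_of_isPushout (hε : IsExactStructure ε) {X Y X' Y' : M} {i : X ⟶ Y}
    {f : X ⟶ X'} {j : Y ⟶ Y'} {i' : X' ⟶ Y'} (sq : IsPushout i f j i') (hi : AdmissibleMono ε i) :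
    AdmissibleMono ε i' := by
  obtain ⟨R, k, l, sq', Z, p, w, h⟩ := hε.pushout i f hi
  let e := sq'.isoIsPushout _ _ sq
  refine ⟨Z, e.inv ≫ p, by simp [e, w], hε.closed_iso
    (ShortComplex.isoMk (S₁ := ShortComplex.mk l p w) (Iso.refl _) e (Iso.refl _) ?_ ?_) h⟩
  · simp [e]
  · simp

/-- Split sequences are conflations. -/
theorem of_splitting (hε : IsExactStructure ε) {S : ShortComplex M} (s : S.Splitting) : ε S := by
  -- The kernel `X` of the identity is zero, and `S.f` is the pushout of the admissible monomorphism
  -- `X ⟶ S.X₃` along `X ⟶ S.X₁`.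
  obtain ⟨X, i, w, h⟩ := hε.id_epi S.X₃
  have hi : i = 0 := by simpa using w
  have : Mono i := hε.mono_f h
  have sq : IsPushout i (0 : X ⟶ S.X₁) s.s S.f := by
    refine ⟨⟨by simp [hi]⟩, ⟨PushoutCocone.IsColimit.mk _ (fun t => S.g ≫ t.inl + s.r ≫ t.inr)
      (fun t => ?_) (fun t => ?_) fun t m h₁ h₂ => ?_⟩⟩
    · simp
    · simp
    · rw [← h₁, ← h₂, ← Category.assoc, ← Category.assoc, ← Preadditive.add_comp, add_comm, s.id,
        Category.id_comp]
  have : Epi S.g := s.epi_g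
  refine hε.of_admissibleMono (hε.admissibleMono_of_isPushout sq ⟨_, _, _, h⟩) S.g S.zero ?_
  intro W k hk
  refine ⟨s.s ≫ k, ?_⟩
  rw [← Category.assoc, s.g_s, Preadditive.sub_comp, Category.assoc, hk, comp_zero, sub_zero,
    Category.id_comp]

theorem splitConflations_eq (hε : IsExactStructure ε) :
    splitConflations ε = fun S => Nonempty S.Splitting := by
  ext S
  exact ⟨fun h => h.2, fun h => ⟨hε.of_splitting h.some, h⟩⟩

theorem admissibleMono_map_id (hε : IsExactStructure ε) {X Y : M} {i : X ⟶ Y}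
    (hi : AdmissibleMono ε i) (Z : M) : AdmissibleMono ε (biprod.map i (𝟙 Z)) := by
  refine hε.admissibleMono_of_isPushout (f := biprod.inl) (j := biprod.inl) ⟨⟨by simp⟩,
    ⟨PushoutCocone.IsColimit.mk _ (fun t => biprod.desc t.inl (biprod.inr ≫ t.inr))
      (fun t => ?_) (fun t => ?_) fun t m h₁ h₂ => ?_⟩⟩ hi
  · simp
  · ext
    · simpa using t.condition
    · simp
  · ext
    · simpa using h₁
    · simp [← h₂]

theorem admissibleMono_id_map (hε : IsExactStructure ε) {X Y : M} {i : X ⟶ Y}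
    (hi : AdmissibleMono ε i) (Z : M) : AdmissibleMono ε (biprod.map (𝟙 Z) i) := by
  refine hε.admissibleMono_of_isPushout (f := biprod.inr) (j := biprod.inr) ⟨⟨by simp⟩,
    ⟨PushoutCocone.IsColimit.mk _ (fun t => biprod.desc (biprod.inl ≫ t.inr) t.inl)
      (fun t => ?_) (fun t => ?_) fun t m h₁ h₂ => ?_⟩⟩ hi
  · simp
  · ext
    · simp
    · simpa using t.condition
  · ext
    · simp [← h₂]
    · simpa using h₁

/-- Conflations are closed under direct sums. -/
theorem biprod (hε : IsExactStructure ε) {S T : ShortComplex M} (hS : ε S) (hT : ε T) :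
    ε (ShortComplex.mk (biprod.map S.f T.f) (biprod.map S.g T.g) (by ext <;> simp)) := by
  have h : AdmissibleMono ε (biprod.map S.f T.f) := by
    have := hε.comp_mono _ _ (hε.admissibleMono_map_id ⟨_, _, _, hS⟩ T.X₁)
      (hε.admissibleMono_id_map ⟨_, _, _, hT⟩ S.X₂)
    rwa [show biprod.map S.f (𝟙 T.X₁) ≫ biprod.map (𝟙 S.X₂) T.f = biprod.map S.f T.f by
      ext <;> simp] at this
  have := hε.epi_g hS
  have := hε.epi_g hT
  refine hε.of_admissibleMono h _ _ ?_
  intro W k hk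
  obtain ⟨l, hl⟩ := hε.exists_desc hS (biprod.inl ≫ k) (by
    rw [← Category.assoc, ← biprod.inl_map S.f T.f, Category.assoc, hk, comp_zero])
  obtain ⟨m, hm⟩ := hε.exists_desc hT (biprod.inr ≫ k) (by
    rw [← Category.assoc, ← biprod.inr_map S.f T.f, Category.assoc, hk, comp_zero])
  exact ⟨biprod.desc l m, by ext <;> simp [hl, hm]⟩

end IsExactStructure

end ExactCategory

/-! ### Conflations modulo split conflations -/

section ConflationsModSplit

variable {M : Type*} [Category M] [Preadditive M] {ε : ObjectProperty (ShortComplex M)}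

/-- The class of a morphism of conflations in the quotient category. -/
abbrev modSplit {S T : ConflationCat ε} (φ : S.obj ⟶ T.obj) :
    (⟨S⟩ : ConflationsModSplit ε) ⟶ ⟨T⟩ :=
  (CategoryTheory.Quotient.functor _).map (ObjectProperty.homMk φ)

theorem exists_modSplit {S T : ConflationCat ε} (f : (⟨S⟩ : ConflationsModSplit ε) ⟶ ⟨T⟩) :
    ∃ φ : S.obj ⟶ T.obj, modSplit φ = f := by
  obtain ⟨φ, hφ⟩ := (CategoryTheory.Quotient.functor _).map_surjective
    (X := S) (Y := T) f
  exact ⟨φ.hom, hφ⟩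

theorem modSplit_comp {S T U : ConflationCat ε} (φ : S.obj ⟶ T.obj) (ψ : T.obj ⟶ U.obj) :
    modSplit (φ ≫ ψ) = modSplit φ ≫ modSplit ψ :=
  (CategoryTheory.Quotient.functor _).map_comp (ObjectProperty.homMk φ) (ObjectProperty.homMk ψ)

theorem modSplit_sub {S T : ConflationCat ε} (φ ψ : S.obj ⟶ T.obj) :
    modSplit (φ - ψ) = modSplit φ - modSplit ψ :=
  (CategoryTheory.Quotient.functor (factorIdeal ((splitConflations ε).inverseImage ε.ι :
    ObjectProperty (ConflationCat ε))).rel).map_sub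
    (f := ObjectProperty.homMk φ) (g := ObjectProperty.homMk ψ)

variable [HasFiniteBiproducts M]

/-- A morphism of conflations whose last component lifts along the deflation of the target also has
a first component that extends along the inflation of the source. -/
theorem IsExactStructure.exists_ext_of_lift (hε : IsExactStructure ε) {S T : ShortComplex M}
    (hT : ε T) (φ : S ⟶ T) (s : S.X₃ ⟶ T.X₂) (hs : s ≫ T.g = φ.τ₃) :
    ∃ r : S.X₂ ⟶ T.X₁, S.f ≫ r = φ.τ₁ ∧ r ≫ T.f + S.g ≫ s = φ.τ₂ := by
  obtain ⟨r, hr⟩ := hε.exists_lift hT (φ.τ₂ - S.g ≫ s) (by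
    rw [Preadditive.sub_comp, φ.comm₂₃, Category.assoc, hs, sub_self])
  have := hε.mono_f hT
  refine ⟨r, ?_, by rw [hr, sub_add_cancel]⟩
  rw [← cancel_mono T.f, Category.assoc, hr, Preadditive.comp_sub, ← φ.comm₁₂, S.zero_assoc,
    zero_comp, sub_zero]

theorem IsExactStructure.exists_lift_of_ext (hε : IsExactStructure ε) {S T : ShortComplex M}
    (hS : ε S) (φ : S ⟶ T) (r : S.X₂ ⟶ T.X₁) (hr : S.f ≫ r = φ.τ₁) :
    ∃ s : S.X₃ ⟶ T.X₂, s ≫ T.g = φ.τ₃ := by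
  obtain ⟨s, hs⟩ := hε.exists_desc hS (φ.τ₂ - r ≫ T.f) (by
    rw [Preadditive.comp_sub, ← φ.comm₁₂, reassoc_of% hr, sub_self])
  have := hε.epi_g hS
  refine ⟨s, ?_⟩
  rw [← cancel_epi S.g, reassoc_of% hs, Preadditive.sub_comp, Category.assoc, T.zero, comp_zero,
    sub_zero, φ.comm₂₃]

/-- A morphism of conflations vanishes modulo split conflations if and only if its last component
lifts along the deflation of the target. -/
theorem modSplit_eq_zero_iff_lift (hε : IsExactStructure ε) {S T : ConflationCat ε}
    (φ : S.obj ⟶ T.obj) :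
    modSplit φ = 0 ↔ ∃ s : S.obj.X₃ ⟶ T.obj.X₂, s ≫ T.obj.g = φ.τ₃ := by
  have h0 : modSplit φ = 0 ↔ ObjectProperty.homMk φ ∈ (factorIdeal
      ((splitConflations ε).inverseImage ε.ι : ObjectProperty (ConflationCat ε))).mor S T := by
    have := CategoryTheory.Quotient.functor_map_eq_iff (factorIdeal
      ((splitConflations ε).inverseImage ε.ι : ObjectProperty (ConflationCat ε))).rel
      (X := S) (Y := T) (ObjectProperty.homMk φ) 0
    rw [Functor.map_zero] at this
    refine this.trans ?_
    rw [HomIdeal.rel, sub_zero]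
  rw [h0]
  constructor
  · suffices h : ∀ f ∈ (factorIdeal ((splitConflations ε).inverseImage ε.ι :
        ObjectProperty (ConflationCat ε))).mor S T,
        ∃ s : S.obj.X₃ ⟶ T.obj.X₂, s ≫ T.obj.g = f.hom.τ₃ from h _
    intro f hf
    induction hf using AddSubgroup.closure_induction with
    | mem f hf =>
      obtain ⟨W, a, b, ⟨-, ⟨σ⟩⟩, rfl⟩ := hf
      refine ⟨a.hom.τ₃ ≫ σ.s ≫ b.hom.τ₂, ?_⟩
      have := b.hom.comm₂₃
      rw [Category.assoc, Category.assoc, this]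
      exact congrArg (a.hom.τ₃ ≫ ·) (σ.s_g_assoc b.hom.τ₃)
    | zero => exact ⟨0, zero_comp⟩
    | add a b _ _ ha hb =>
      obtain ⟨s, hs⟩ := ha
      obtain ⟨t, ht⟩ := hb
      exact ⟨s + t, by rw [Preadditive.add_comp, hs, ht]; rfl⟩
    | neg a _ ha =>
      obtain ⟨s, hs⟩ := ha
      exact ⟨-s, by rw [Preadditive.neg_comp, hs]; rfl⟩
  · rintro ⟨s, hs⟩
    obtain ⟨r, hr, hrs⟩ := hε.exists_ext_of_lift T.property φ s hs
    have σ : (ShortComplex.mk (biprod.inl : T.obj.X₁ ⟶ T.obj.X₁ ⊞ S.obj.X₃) biprod.snd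
        (by simp)).Splitting := { r := biprod.fst, s := biprod.inr }
    refine AddSubgroup.subset_closure ⟨⟨_, hε.of_splitting σ⟩,
      ObjectProperty.homMk
        { τ₁ := φ.τ₁, τ₂ := biprod.lift r S.obj.g, τ₃ := 𝟙 _, comm₁₂ := ?_, comm₂₃ := ?_ },
      ObjectProperty.homMk
        { τ₁ := 𝟙 _, τ₂ := biprod.desc T.obj.f s, τ₃ := φ.τ₃, comm₁₂ := ?_, comm₂₃ := ?_ },
      ⟨hε.of_splitting σ, ⟨σ⟩⟩, ?_⟩
    · dsimp; ext <;> simp [hr]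
    · simp
    · simp
    · dsimp; ext <;> simp [hs]
    · apply ObjectProperty.hom_ext
      apply ShortComplex.hom_ext
      · simp
      · simp [hrs]
      · simp

/-- A morphism of conflations vanishes modulo split conflations if and only if its first component
extends along the inflation of the source. -/
theorem modSplit_eq_zero_iff_ext (hε : IsExactStructure ε) {S T : ConflationCat ε}
    (φ : S.obj ⟶ T.obj) :
    modSplit φ = 0 ↔ ∃ r : S.obj.X₂ ⟶ T.obj.X₁, S.obj.f ≫ r = φ.τ₁ := by
  rw [modSplit_eq_zero_iff_lift hε]
  constructor
  · rintro ⟨s, hs⟩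
    obtain ⟨r, hr, -⟩ := hε.exists_ext_of_lift T.property φ s hs
    exact ⟨r, hr⟩
  · rintro ⟨r, hr⟩
    exact hε.exists_lift_of_ext S.property φ r hr

theorem modSplit_eq_of_τ₁ (hε : IsExactStructure ε) {S T : ConflationCat ε}
    (φ ψ : S.obj ⟶ T.obj) (h : φ.τ₁ = ψ.τ₁) : modSplit φ = modSplit ψ := by
  rw [← sub_eq_zero, ← modSplit_sub, modSplit_eq_zero_iff_ext hε]
  exact ⟨0, by simp [h]⟩

theorem modSplit_eq_of_τ₃ (hε : IsExactStructure ε) {S T : ConflationCat ε}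
    (φ ψ : S.obj ⟶ T.obj) (h : φ.τ₃ = ψ.τ₃) : modSplit φ = modSplit ψ := by
  rw [← sub_eq_zero, ← modSplit_sub, modSplit_eq_zero_iff_lift hε]
  exact ⟨0, by simp [h]⟩

/-- A morphism of conflations whose first component is an isomorphism is a monomorphism modulo
split conflations. -/
theorem mono_modSplit (hε : IsExactStructure ε) {S T : ConflationCat ε} (φ : S.obj ⟶ T.obj)
    [IsIso φ.τ₁] : Mono (modSplit φ) := by
  refine Preadditive.mono_of_cancel_zero _ fun {U} g hg => ?_
  obtain ⟨U⟩ := U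
  obtain ⟨ψ, rfl⟩ := exists_modSplit g
  rw [← modSplit_comp, modSplit_eq_zero_iff_ext hε] at hg
  obtain ⟨r, hr⟩ := hg
  rw [modSplit_eq_zero_iff_ext hε]
  exact ⟨r ≫ inv φ.τ₁, by simp [reassoc_of% hr]⟩

theorem epi_modSplit (hε : IsExactStructure ε) {S T : ConflationCat ε} (φ : S.obj ⟶ T.obj)
    [IsIso φ.τ₃] : Epi (modSplit φ) := by
  refine Preadditive.epi_of_cancel_zero _ fun {U} g hg => ?_
  obtain ⟨U⟩ := U
  obtain ⟨ψ, rfl⟩ := exists_modSplit g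
  rw [← modSplit_comp, modSplit_eq_zero_iff_lift hε] at hg
  obtain ⟨s, hs⟩ := hg
  rw [modSplit_eq_zero_iff_lift hε]
  exact ⟨inv φ.τ₃ ≫ s, by simp [hs]⟩

/-- The kernel of a morphism of conflations `φ : S ⟶ T` modulo split conflations is the pullback of
`S` along the projection to `S.X₃` of the pullback of `T.g` along `φ.τ₃`. -/
theorem exists_kernel_modSplit (hε : IsExactStructure ε) {S T : ConflationCat ε}
    (φ : S.obj ⟶ T.obj) {B : M} {x : B ⟶ T.obj.X₂} {p : B ⟶ S.obj.X₃}
    (sq : IsPullback x p T.obj.g φ.τ₃) :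
    ∃ (K : ConflationCat ε) (κ : K.obj ⟶ S.obj) (e : B ⟶ K.obj.X₃), e ≫ κ.τ₃ = p ∧
      ∃ w : modSplit κ ≫ modSplit φ = 0, Nonempty (IsLimit (KernelFork.ofι _ w)) := by
  obtain ⟨P, u, q, i, w, sq', hK, hi⟩ := hε.exists_pullback S.property p
  let K : ConflationCat ε := ⟨ShortComplex.mk i q w, hK⟩
  let κ : K.obj ⟶ S.obj :=
    { τ₁ := 𝟙 S.obj.X₁, τ₂ := u, τ₃ := p, comm₁₂ := by simp [K, hi], comm₂₃ := sq'.w }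
  have : IsIso κ.τ₁ := inferInstanceAs (IsIso (𝟙 _))
  have := mono_modSplit hε κ
  have hw : modSplit κ ≫ modSplit φ = 0 := by
    rw [← modSplit_comp, modSplit_eq_zero_iff_lift hε]
    exact ⟨x, sq.w⟩
  refine ⟨K, κ, 𝟙 _, Category.id_comp _, hw, ⟨KernelFork.IsLimit.ofι' _ hw fun {U} g hg =>
    Classical.choice ?_⟩⟩
  obtain ⟨U⟩ := U
  obtain ⟨ψ, rfl⟩ := exists_modSplit g
  rw [← modSplit_comp, modSplit_eq_zero_iff_lift hε] at hg
  obtain ⟨s, hs⟩ := hg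
  rw [ShortComplex.comp_τ₃] at hs
  have h₁ : ψ.τ₂ ≫ S.obj.g = (U.obj.g ≫ sq.lift s ψ.τ₃ hs) ≫ p := by simp [ψ.comm₂₃]
  have h₂ : U.obj.f ≫ sq'.lift ψ.τ₂ _ h₁ = ψ.τ₁ ≫ i := by
    apply sq'.hom_ext
    · simp [hi, ψ.comm₁₂]
    · simp [w]
  refine ⟨modSplit (T := K) { τ₁ := ψ.τ₁, τ₂ := sq'.lift ψ.τ₂ _ h₁, τ₃ := sq.lift s ψ.τ₃ hs,
                              comm₁₂ := h₂.symm, comm₂₃ := sq'.lift_snd _ _ _ }, ?_⟩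
  rw [← modSplit_comp]
  exact modSplit_eq_of_τ₁ hε _ _ (Category.comp_id _)

/-- The cokernel of a morphism of conflations `φ : S ⟶ T` modulo split conflations is the pushout
of `T` along the coprojection from `T.X₁` to the pushout of `S.f` along `φ.τ₁`. -/
theorem exists_cokernel_modSplit (hε : IsExactStructure ε) {S T : ConflationCat ε}
    (φ : S.obj ⟶ T.obj) {B : M} {x : S.obj.X₂ ⟶ B} {i : T.obj.X₁ ⟶ B}
    (sq : IsPushout S.obj.f φ.τ₁ x i) :
    ∃ (C : ConflationCat ε) (π : T.obj ⟶ C.obj) (e : C.obj.X₁ ⟶ B), π.τ₁ ≫ e = i ∧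
      ∃ w : modSplit φ ≫ modSplit π = 0, Nonempty (IsColimit (CokernelCofork.ofπ _ w)) := by
  obtain ⟨R, u, j, p, w, sq', hC, hp⟩ := hε.exists_pushout T.property i
  let C : ConflationCat ε := ⟨ShortComplex.mk j p w, hC⟩
  let π : T.obj ⟶ C.obj :=
    { τ₁ := i, τ₂ := u, τ₃ := 𝟙 T.obj.X₃, comm₁₂ := sq'.w.symm, comm₂₃ := by simp [C, hp] }
  have : IsIso π.τ₃ := inferInstanceAs (IsIso (𝟙 _))
  have := epi_modSplit hε π
  have hw : modSplit φ ≫ modSplit π = 0 := by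
    rw [← modSplit_comp, modSplit_eq_zero_iff_ext hε]
    exact ⟨x, sq.w⟩
  refine ⟨C, π, 𝟙 _, Category.comp_id _, hw, ⟨CokernelCofork.IsColimit.ofπ' _ hw fun {U} g hg =>
    Classical.choice ?_⟩⟩
  obtain ⟨U⟩ := U
  obtain ⟨ψ, rfl⟩ := exists_modSplit g
  rw [← modSplit_comp, modSplit_eq_zero_iff_ext hε] at hg
  obtain ⟨r, hr⟩ := hg
  rw [ShortComplex.comp_τ₁] at hr
  have h₁ : T.obj.f ≫ ψ.τ₂ = i ≫ sq.desc r ψ.τ₁ hr ≫ U.obj.f := by simp [ψ.comm₁₂]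
  have h₂ : sq'.desc ψ.τ₂ _ h₁ ≫ U.obj.g = p ≫ ψ.τ₃ := by
    apply sq'.hom_ext
    · simp [reassoc_of% hp, ψ.comm₂₃]
    · simp [reassoc_of% w]
  refine ⟨modSplit (S := C) { τ₁ := sq.desc r ψ.τ₁ hr, τ₂ := sq'.desc ψ.τ₂ _ h₁, τ₃ := ψ.τ₃,
                              comm₁₂ := (sq'.inr_desc _ _ _).symm, comm₂₃ := h₂ }, ?_⟩
  rw [← modSplit_comp]
  exact modSplit_eq_of_τ₃ hε _ _ (Category.id_comp _)

/-- A morphism of conflations that is a monomorphism modulo split conflations is the kernel of its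
cokernel: it is isomorphic to the comparison of the pushout of its source along its first component
with its target. -/
theorem normalMono_modSplit (hε : IsExactStructure ε) {S T : ConflationCat ε}
    (φ : S.obj ⟶ T.obj) [Mono (modSplit φ)] : Nonempty (NormalMono (modSplit φ)) := by
  obtain ⟨R, j, i, p, w, sqo, hR, hj⟩ := hε.exists_pushout S.property φ.τ₁
  obtain ⟨P, u, q, k, w', sqb, -, hk⟩ := hε.exists_pullback T.property φ.τ₃
  obtain ⟨C, π, e', he', hπ, -⟩ := exists_cokernel_modSplit hε φ sqo
  obtain ⟨K, κ, e, he, hκ, -⟩ := exists_kernel_modSplit hε φ sqb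
  let I : ConflationCat ε := ⟨ShortComplex.mk i p w, hR⟩
  have hb : sqo.desc φ.τ₂ T.obj.f φ.comm₁₂.symm ≫ T.obj.g = p ≫ φ.τ₃ :=
    sqo.hom_ext (by simp [reassoc_of% hj, φ.comm₂₃]) (by simp [reassoc_of% w])
  let m : I.obj ⟶ T.obj :=
    { τ₁ := 𝟙 T.obj.X₁, τ₂ := sqo.desc φ.τ₂ T.obj.f φ.comm₁₂.symm, τ₃ := φ.τ₃,
      comm₁₂ := (Category.id_comp _).trans (sqo.inr_desc _ _ _).symm, comm₂₃ := hb }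
  -- Since the kernel of `φ` vanishes, the deflation `p` of `I` lifts along that of `S`.
  obtain ⟨s, hs⟩ := (modSplit_eq_zero_iff_lift hε κ).1 (Limits.zero_of_comp_mono _ hκ)
  have hlift : (sqb.lift _ p hb ≫ e ≫ s) ≫ S.obj.g = p := by simp [hs, he]
  obtain ⟨a, ha⟩ := hε.exists_lift S.property (i ≫ sqb.lift _ p hb ≫ e ≫ s)
    (by rw [Category.assoc, hlift, w])
  let v : I.obj ⟶ S.obj :=
    { τ₁ := a, τ₂ := sqb.lift _ p hb ≫ e ≫ s, τ₃ := 𝟙 S.obj.X₃,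
      comm₁₂ := ha, comm₂₃ := hlift.trans (Category.comp_id _).symm }
  have hv : modSplit v ≫ modSplit φ = modSplit m := by
    rw [← modSplit_comp]
    exact modSplit_eq_of_τ₃ hε _ _ (Category.id_comp _)
  refine ⟨⟨⟨C⟩, modSplit π, hπ, KernelFork.IsLimit.ofι' _ hπ fun {U} g hg => Classical.choice ?_⟩⟩
  obtain ⟨U⟩ := U
  obtain ⟨ψ, rfl⟩ := exists_modSplit g
  rw [← modSplit_comp, modSplit_eq_zero_iff_ext hε] at hg
  obtain ⟨r, hr⟩ := hg
  have hr' : U.obj.f ≫ r ≫ e' = ψ.τ₁ ≫ i := by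
    rw [reassoc_of% hr, ShortComplex.comp_τ₁, Category.assoc, he']
  obtain ⟨l, hl⟩ := hε.exists_desc U.property ((r ≫ e') ≫ p)
    (by rw [← Category.assoc, hr', Category.assoc, w, comp_zero])
  let θ : U.obj ⟶ I.obj :=
    { τ₁ := ψ.τ₁, τ₂ := r ≫ e', τ₃ := l, comm₁₂ := hr'.symm, comm₂₃ := hl.symm }
  refine ⟨modSplit θ ≫ modSplit v, ?_⟩
  rw [Category.assoc, hv, ← modSplit_comp]
  exact modSplit_eq_of_τ₁ hε _ _ (Category.comp_id _)

/-- A morphism of conflations that is an epimorphism modulo split conflations is the cokernel of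
its kernel. -/
theorem normalEpi_modSplit (hε : IsExactStructure ε) {S T : ConflationCat ε}
    (φ : S.obj ⟶ T.obj) [Epi (modSplit φ)] : Nonempty (NormalEpi (modSplit φ)) := by
  obtain ⟨R, j, i, p, w, sqo, -, hj⟩ := hε.exists_pushout S.property φ.τ₁
  obtain ⟨P, u, q, k, w', sqb, hP, hk⟩ := hε.exists_pullback T.property φ.τ₃
  obtain ⟨C, π, e', he', hπ, -⟩ := exists_cokernel_modSplit hε φ sqo
  obtain ⟨K, κ, e, he, hκ, -⟩ := exists_kernel_modSplit hε φ sqb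
  let I : ConflationCat ε := ⟨ShortComplex.mk k q w', hP⟩
  have hb : φ.τ₁ ≫ k = S.obj.f ≫ sqb.lift φ.τ₂ S.obj.g φ.comm₂₃ :=
    sqb.hom_ext (by simp [hk, φ.comm₁₂]) (by simp [w'])
  let m : S.obj ⟶ I.obj :=
    { τ₁ := φ.τ₁, τ₂ := sqb.lift φ.τ₂ S.obj.g φ.comm₂₃, τ₃ := 𝟙 S.obj.X₃,
      comm₁₂ := hb, comm₂₃ := (sqb.lift_snd _ _ _).trans (Category.comp_id _).symm }
  -- Since the cokernel of `φ` vanishes, the inflation `k` of `I` extends along that of `T`.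
  obtain ⟨s, hs⟩ := (modSplit_eq_zero_iff_ext hε π).1 (Limits.zero_of_epi_comp _ hπ)
  have hext : T.obj.f ≫ s ≫ e' ≫ sqo.desc _ k hb.symm = k := by
    rw [reassoc_of% hs, reassoc_of% he', sqo.inr_desc]
  obtain ⟨c, hc⟩ := hε.exists_desc T.property ((s ≫ e' ≫ sqo.desc _ k hb.symm) ≫ q)
    (by rw [← Category.assoc, hext, w'])
  let v : T.obj ⟶ I.obj :=
    { τ₁ := 𝟙 T.obj.X₁, τ₂ := s ≫ e' ≫ sqo.desc _ k hb.symm, τ₃ := c,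
      comm₁₂ := (Category.id_comp _).trans hext.symm, comm₂₃ := hc.symm }
  have hv : modSplit φ ≫ modSplit v = modSplit m := by
    rw [← modSplit_comp]
    exact modSplit_eq_of_τ₁ hε _ _ (Category.comp_id _)
  refine ⟨⟨⟨K⟩, modSplit κ, hκ,
    CokernelCofork.IsColimit.ofπ' _ hκ fun {U} g hg => Classical.choice ?_⟩⟩
  obtain ⟨U⟩ := U
  obtain ⟨ψ, rfl⟩ := exists_modSplit g
  rw [← modSplit_comp, modSplit_eq_zero_iff_lift hε] at hg
  obtain ⟨r, hr⟩ := hg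
  have hr' : (e ≫ r) ≫ U.obj.g = q ≫ ψ.τ₃ := by
    rw [Category.assoc, hr, ShortComplex.comp_τ₃, reassoc_of% he]
  obtain ⟨l, hl⟩ := hε.exists_lift U.property (k ≫ e ≫ r)
    (by rw [Category.assoc, hr', reassoc_of% w', zero_comp])
  let θ : I.obj ⟶ U.obj :=
    { τ₁ := l, τ₂ := e ≫ r, τ₃ := ψ.τ₃, comm₁₂ := hl, comm₂₃ := hr' }
  refine ⟨modSplit v ≫ modSplit θ, ?_⟩
  rw [reassoc_of% hv, ← modSplit_comp]
  exact modSplit_eq_of_τ₃ hε _ _ (Category.id_comp _)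

theorem hasFiniteProducts_conflationCat (hε : IsExactStructure ε) :
    HasFiniteProducts (ConflationCat ε) := by
  have : HasBinaryBiproducts (ConflationCat ε) := ⟨fun S T => by
    let B : ConflationCat ε := ⟨_, hε.biprod S.property T.property⟩
    refine hasBinaryBiproduct_of_total (BinaryBicone.mk (P := S) (Q := T) B
      (ObjectProperty.homMk { τ₁ := biprod.fst, τ₂ := biprod.fst, τ₃ := biprod.fst })
      (ObjectProperty.homMk { τ₁ := biprod.snd, τ₂ := biprod.snd, τ₃ := biprod.snd })
      (ObjectProperty.homMk { τ₁ := biprod.inl, τ₂ := biprod.inl, τ₃ := biprod.inl })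
      (ObjectProperty.homMk { τ₁ := biprod.inr, τ₂ := biprod.inr, τ₃ := biprod.inr })
      ?_ ?_ ?_ ?_) ?_
    all_goals
      apply ObjectProperty.hom_ext
      apply ShortComplex.hom_ext <;> first | (simp [B]; done) | exact biprod.total⟩
  have : HasZeroObject (ConflationCat ε) := by
    obtain ⟨Z, hZ⟩ := (inferInstance : HasZeroObject M)
    have σ : (ShortComplex.mk (0 : Z ⟶ Z) (0 : Z ⟶ Z) comp_zero).Splitting :=
      { r := 0, s := 0, f_r := hZ.eq_of_src _ _, s_g := hZ.eq_of_src _ _, id := hZ.eq_of_src _ _ }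
    refine ⟨⟨_, hε.of_splitting σ⟩, (IsZero.iff_id_eq_zero _).2 ?_⟩
    apply ObjectProperty.hom_ext
    apply ShortComplex.hom_ext <;> exact hZ.eq_of_src _ _
  exact hasFiniteProducts_of_has_binary_and_terminal

/-- The conflations of an exact category modulo the split conflations form an abelian category. -/
theorem IsExactStructure.abelian (hε : IsExactStructure ε) :
    Nonempty (Abelian (ConflationsModSplit ε)) := by
  have := hasFiniteProducts_conflationCat hε
  have : HasFiniteBiproducts (ConflationCat ε) := HasFiniteBiproducts.of_hasFiniteProducts
  have : HasKernels (ConflationsModSplit ε) := ⟨fun {S T} f => by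
    obtain ⟨φ, rfl⟩ := exists_modSplit (S := S.as) (T := T.as) f
    obtain ⟨P, u, q, -, -, sq, -, -⟩ := hε.exists_pullback T.as.property φ.τ₃
    obtain ⟨K, κ, e, -, w, ⟨h⟩⟩ := exists_kernel_modSplit hε φ sq
    exact ⟨⟨_, h⟩⟩⟩
  have : HasCokernels (ConflationsModSplit ε) := ⟨fun {S T} f => by
    obtain ⟨φ, rfl⟩ := exists_modSplit (S := S.as) (T := T.as) f
    obtain ⟨R, j, i, -, -, sq, -, -⟩ := hε.exists_pushout S.as.property φ.τ₁
    obtain ⟨C, π, e, -, w, ⟨h⟩⟩ := exists_cokernel_modSplit hε φ sq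
    exact ⟨⟨_, h⟩⟩⟩
  have : IsNormalMonoCategory (ConflationsModSplit ε) := ⟨fun {S T} f _ => by
    obtain ⟨φ, rfl⟩ := exists_modSplit (S := S.as) (T := T.as) f
    exact normalMono_modSplit hε φ⟩
  have : IsNormalEpiCategory (ConflationsModSplit ε) := ⟨fun {S T} f _ => by
    obtain ⟨φ, rfl⟩ := exists_modSplit (S := S.as) (T := T.as) f
    exact normalEpi_modSplit hε φ⟩
  exact ⟨{ has_finite_products := inferInstance }⟩

end ConflationsModSplit

/-! ### Modules presented by a morphism -/

section Modules

universe w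

variable {ℬ : Type*} [Category ℬ]

theorem map_comp_apply' (T : ℬ ⥤ AddCommGrpCat.{w}) {U V W : ℬ} (f : U ⟶ V) (g : V ⟶ W)
    (x : T.obj U) : T.map (f ≫ g) x = T.map g (T.map f x) := by simp

theorem app_map (T T' : ℬ ⥤ AddCommGrpCat.{w}) (τ : T ⟶ T') {U V : ℬ} (f : U ⟶ V)
    (x : T.obj U) : τ.app V (T.map f x) = T'.map f (τ.app U x) :=
  NatTrans.naturality_apply τ f x

/-- The element `δ` of `T.obj L` generates the module `T` with the relations that `q` imposes, that
is, the sequence `Hom(X, -) ⟶ Hom(L, -) ⟶ T ⟶ 0` defined by `q` and `δ` is exact. -/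
structure IsPresentedBy {L X : ℬ} (q : L ⟶ X) (T : ℬ ⥤ AddCommGrpCat.{w}) (δ : T.obj L) :
    Prop where
  exists_eq : ∀ {V : ℬ} (ξ : T.obj V), ∃ c : L ⟶ V, T.map c δ = ξ
  map_eq_zero_iff : ∀ {V : ℬ} (c : L ⟶ V), T.map c δ = 0 ↔ ∃ t : X ⟶ V, q ≫ t = c

theorem IsPresentedBy.of_map_eq_zero {L X : ℬ} {q : L ⟶ X} {T : ℬ ⥤ AddCommGrpCat.{w}}
    {δ : T.obj L} (h₀ : T.map q δ = 0)
    (h₁ : ∀ {V : ℬ} (ξ : T.obj V), ∃ c : L ⟶ V, T.map c δ = ξ)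
    (h₂ : ∀ {V : ℬ} (c : L ⟶ V), T.map c δ = 0 → ∃ t : X ⟶ V, q ≫ t = c) :
    IsPresentedBy q T δ :=
  ⟨h₁, fun c => ⟨h₂ c, by rintro ⟨t, rfl⟩; rw [map_comp_apply', h₀, map_zero]⟩⟩

theorem IsPresentedBy.of_iso {L X : ℬ} {q : L ⟶ X}
    {T T' : ℬ ⥤ AddCommGrpCat.{w}} {δ : T.obj L} (h : IsPresentedBy q T δ) (e : T ≅ T') :
    IsPresentedBy q T' (e.hom.app L δ) := by
  have h₁ {V : ℬ} (ξ : T'.obj V) : e.hom.app V (e.inv.app V ξ) = ξ := by simp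
  have h₂ {V : ℬ} (ξ : T.obj V) : e.inv.app V (e.hom.app V ξ) = ξ := by simp
  refine ⟨fun {V} ξ => ?_, fun {V} c => ?_⟩
  · obtain ⟨c, hc⟩ := h.exists_eq (e.inv.app V ξ)
    exact ⟨c, by rw [← app_map, hc, h₁]⟩
  · rw [← h.map_eq_zero_iff, ← app_map]
    exact ⟨fun hc => by rw [← h₂ (T.map c δ), hc, map_zero], fun hc => by rw [hc, map_zero]⟩

theorem shortExact_app {E : ShortComplex (ℬ ⥤ AddCommGrpCat.{w})} (hE : E.ShortExact) (V : ℬ) :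
    Function.Injective (E.f.app V) ∧
    (∀ y : E.X₂.obj V, E.g.app V y = 0 → ∃ x : E.X₁.obj V, E.f.app V x = y) ∧
    Function.Surjective (E.g.app V) := by
  have h := hE.map_of_exact ((evaluation ℬ AddCommGrpCat.{w}).obj V)
  exact ⟨h.ab_injective_f, (ShortComplex.ab_exact_iff _).1 h.exact, h.ab_surjective_g⟩

variable [Preadditive ℬ]

theorem map_add_apply (T : ℬ ⥤ AddCommGrpCat.{w}) [T.Additive] {U V : ℬ} (f g : U ⟶ V)
    (x : T.obj U) : T.map (f + g) x = T.map f x + T.map g x := by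
  rw [T.map_add]; rfl

theorem map_sub_apply (T : ℬ ⥤ AddCommGrpCat.{w}) [T.Additive] {U V : ℬ} (f g : U ⟶ V)
    (x : T.obj U) : T.map (f - g) x = T.map f x - T.map g x := by
  rw [T.map_sub]; rfl

theorem map_zero_apply (T : ℬ ⥤ AddCommGrpCat.{w}) [T.Additive] {U V : ℬ}
    (x : T.obj U) : T.map (0 : U ⟶ V) x = 0 := by
  rw [T.map_zero]; rfl

section Iso

variable {L X : ℬ} {q : L ⟶ X} {T T' : ℬ ⥤ AddCommGrpCat.{w}} {δ : T.obj L} {δ' : T'.obj L}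
  [T.Additive] [T'.Additive]

theorem IsPresentedBy.map_eq_map (h : IsPresentedBy q T δ) (h' : IsPresentedBy q T' δ') {V : ℬ}
    {c c' : L ⟶ V} (hc : T.map c δ = T.map c' δ) : T'.map c δ' = T'.map c' δ' := by
  rw [← sub_eq_zero, ← map_sub_apply] at hc ⊢
  rwa [h'.map_eq_zero_iff, ← h.map_eq_zero_iff]

/-- Modules presented by the same morphism are isomorphic. -/
theorem IsPresentedBy.nonempty_iso (h : IsPresentedBy q T δ) (h' : IsPresentedBy q T' δ') :
    Nonempty (T ≅ T') := by
  choose c hc using fun V : ℬ => fun ξ : T.obj V => h.exists_eq ξ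
  choose c' hc' using fun V : ℬ => fun ξ : T'.obj V => h'.exists_eq ξ
  let e (V : ℬ) : T.obj V ≃+ T'.obj V :=
    { toFun := fun ξ => T'.map (c V ξ) δ'
      invFun := fun ξ => T.map (c' V ξ) δ
      left_inv := fun ξ => (h'.map_eq_map h (hc' V _)).trans (hc V ξ)
      right_inv := fun ξ => (h.map_eq_map h' (hc V _)).trans (hc' V ξ)
      map_add' := fun ξ η => by
        rw [← map_add_apply]
        exact h.map_eq_map h' (by rw [map_add_apply, hc, hc, hc]) }
  refine ⟨NatIso.ofComponents (fun V => (e V).toAddCommGrpIso) fun {V W} f => ?_⟩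
  ext ξ
  change T'.map (c W (T.map f ξ)) δ' = T'.map f (T'.map (c V ξ) δ')
  rw [← map_comp_apply']
  exact h.map_eq_map h' (by rw [map_comp_apply', hc, hc])

end Iso

section Extension

variable {E : ShortComplex (ℬ ⥤ AddCommGrpCat.{w})}

/-- An extension of additive functors is additive: an element of the middle term at a direct sum is
the sum of its two components, because this holds for the outer terms. -/
theorem additive_of_shortExact [HasBinaryBiproducts ℬ] (hE : E.ShortExact) [E.X₁.Additive]
    [E.X₃.Additive] : E.X₂.Additive := by
  -- Zero morphisms act on `E.X₂` with values in the image of `E.X₁`, where they act as zero, and a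
  -- zero morphism is its own composition with a zero morphism.
  have hz (U V : ℬ) (x : E.X₂.obj U) : E.X₂.map (0 : U ⟶ V) x = 0 := by
    obtain ⟨a, ha⟩ := (shortExact_app hE V).2.1 (E.X₂.map (0 : U ⟶ V) x)
      (by rw [app_map, map_zero_apply])
    rw [show (0 : U ⟶ V) = 0 ≫ (0 : V ⟶ V) by simp, map_comp_apply', ← ha, ← app_map,
      map_zero_apply, map_zero]
  have hb (U : ℬ) (x : E.X₂.obj (U ⊞ U)) : x = E.X₂.map (biprod.fst ≫ biprod.inl) x +
      E.X₂.map (biprod.snd ≫ biprod.inr) x := by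
    obtain ⟨a, ha⟩ := (shortExact_app hE (U ⊞ U)).2.1
      (x - (E.X₂.map (biprod.fst ≫ biprod.inl) x + E.X₂.map (biprod.snd ≫ biprod.inr) x)) (by
        rw [map_sub, map_add, app_map, app_map, ← map_add_apply, biprod.total,
          CategoryTheory.Functor.map_id]
        exact sub_self _)
    have ha' : a = E.X₁.map (biprod.fst ≫ biprod.inl) a + E.X₁.map (biprod.snd ≫ biprod.inr) a := by
      rw [← map_add_apply, biprod.total, CategoryTheory.Functor.map_id]
      rfl
    rw [← sub_eq_zero, ← ha, ha', map_add, app_map, app_map, ha, map_sub, map_sub, map_add, map_add]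
    simp only [← map_comp_apply']
    simp [hz]
  -- `f + g` is the composition of `biprod.lift f g` with the codiagonal of `V`.
  refine ⟨fun {U V f g} => ?_⟩
  ext x
  have h := hb V (E.X₂.map (biprod.lift f g) x)
  have h2 := congrArg (E.X₂.map (biprod.desc (𝟙 V) (𝟙 V))) h
  rw [map_add] at h2
  simp only [← map_comp_apply'] at h2
  simpa using h2

/-- The horseshoe lemma: an extension of modules presented by `q'` and `q''` is presented by a
triangular matrix with diagonal entries `q'` and `q''`. The direct sums on which the matrix is
formed are arbitrary bicones, only the first of which has to be a direct sum. -/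
theorem IsPresentedBy.exists_extension (hE : E.ShortExact) [E.X₁.Additive] {L' X' L'' X'' : ℬ}
    {q' : L' ⟶ X'} {q'' : L'' ⟶ X''} {δ' : E.X₁.obj L'} {δ'' : E.X₃.obj L''}
    (h' : IsPresentedBy q' E.X₁ δ') (h'' : IsPresentedBy q'' E.X₃ δ'') :
    ∃ h : L' ⟶ X'', ∀ (bL : BinaryBicone L' L'') (bX : BinaryBicone X' X'') (q : bL.pt ⟶ bX.pt),
      bL.fst ≫ bL.inl + bL.snd ≫ bL.inr = 𝟙 bL.pt →
      bL.inl ≫ q = q' ≫ bX.inl - h ≫ bX.inr → bL.inr ≫ q = q'' ≫ bX.inr →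
      ∃ z : E.X₂.obj bL.pt, IsPresentedBy q E.X₂ z := by
  -- A lift `y` of the generator `δ''` need not satisfy the relation `q''`; the defect is the image
  -- of the generator `δ'` under `h`, which up to sign becomes the entry
  -- outside the diagonal.
  obtain ⟨y, hy⟩ := (shortExact_app hE L'').2.2 δ''
  obtain ⟨η, hη⟩ := (shortExact_app hE X'').2.1 (E.X₂.map q'' y)
    (by rw [app_map, hy, h''.map_eq_zero_iff]; exact ⟨𝟙 _, Category.comp_id _⟩)
  obtain ⟨h, rfl⟩ := h'.exists_eq η
  have h0 : E.X₁.map q' δ' = 0 := (h'.map_eq_zero_iff q').2 ⟨𝟙 _, Category.comp_id _⟩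
  refine ⟨h, fun bL bX q tL hl hr => ⟨E.X₂.map bL.inl (E.f.app L' δ') + E.X₂.map bL.inr y, ?_⟩⟩
  have hz {V : ℬ} (c : bL.pt ⟶ V) :
      E.X₂.map c (E.X₂.map bL.inl (E.f.app L' δ') + E.X₂.map bL.inr y) =
        E.f.app V (E.X₁.map (bL.inl ≫ c) δ') + E.X₂.map (bL.inr ≫ c) y := by
    rw [map_add, ← map_comp_apply', ← map_comp_apply', app_map]
  have hext {V : ℬ} {c c' : bL.pt ⟶ V} (h₁ : bL.inl ≫ c = bL.inl ≫ c')
      (h₂ : bL.inr ≫ c = bL.inr ≫ c') : c = c' := by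
    rw [← Category.id_comp c, ← Category.id_comp c', ← tL, Preadditive.add_comp,
      Preadditive.add_comp, Category.assoc, Category.assoc, h₁, h₂, Category.assoc, Category.assoc]
  refine ⟨fun {V} ξ => ?_, fun {V} c => ?_⟩
  · obtain ⟨c'', hc''⟩ := h''.exists_eq (E.g.app V ξ)
    obtain ⟨x, hx⟩ := (shortExact_app hE V).2.1 (ξ - E.X₂.map c'' y)
      (by rw [map_sub, app_map, hy, hc'', sub_self])
    obtain ⟨c', rfl⟩ := h'.exists_eq x
    refine ⟨bL.fst ≫ c' + bL.snd ≫ c'', ?_⟩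
    rw [hz]
    simp only [Preadditive.comp_add, BinaryBicone.inl_fst_assoc, BinaryBicone.inl_snd_assoc,
      BinaryBicone.inr_fst_assoc, BinaryBicone.inr_snd_assoc, zero_comp, add_zero, zero_add]
    rw [hx, sub_add_cancel]
  · rw [hz]
    constructor
    · intro hc
      have hp := congrArg (E.g.app V) hc
      rw [map_add, map_zero, app_map (τ := E.g), hy] at hp
      have hfg (x : E.X₁.obj V) : E.g.app V (E.f.app V x) = 0 := by
        have := NatTrans.congr_app E.zero V
        exact ConcreteCategory.congr_hom this x
      rw [hfg, zero_add, h''.map_eq_zero_iff] at hp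
      obtain ⟨t'', ht''⟩ := hp
      rw [← ht'', map_comp_apply' _ q'' t'', ← hη, ← app_map, ← map_add,
        ← map_comp_apply', ← map_add_apply] at hc
      have hc' := (shortExact_app hE V).1 (hc.trans (map_zero _).symm)
      rw [h'.map_eq_zero_iff] at hc'
      obtain ⟨t', ht'⟩ := hc'
      refine ⟨bX.fst ≫ t' + bX.snd ≫ t'', hext ?_ ?_⟩
      · rw [reassoc_of% hl]
        simp [ht']
      · rw [reassoc_of% hr]
        simp [ht'']
    · rintro ⟨t, rfl⟩
      rw [reassoc_of% hl, reassoc_of% hr, Preadditive.sub_comp, map_sub_apply, Category.assoc,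
        Category.assoc, map_comp_apply', h0, map_zero, zero_sub, map_neg, map_comp_apply', app_map,
        hη, map_comp_apply' _ q'', map_comp_apply' _ bX.inr, neg_add_cancel]

end Extension

end Modules

/-! ### Inflations and deflations -/

section Deflations

variable {𝒞 : Type u} [SmallCategory 𝒞] [Preadditive 𝒞] [HasFiniteBiproducts 𝒞]
  [Extriangulated 𝒞]

/-- `x` is the first morphism of a conflation. -/
def IsInflation {A B : 𝒞} (x : A ⟶ B) : Prop := ∃ (C : 𝒞) (y : B ⟶ C), Conflation x y

/-- `y` is the last morphism of a conflation. -/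
def IsDeflation {B C : 𝒞} (y : B ⟶ C) : Prop := ∃ (A : 𝒞) (x : A ⟶ B), Conflation x y

theorem IsInflation.comp {A B C : 𝒞} {f : A ⟶ B} {g : B ⟶ C} (hf : IsInflation f)
    (hg : IsInflation g) : IsInflation (f ≫ g) := by
  obtain ⟨D, f', δ, hf⟩ := hf
  obtain ⟨F, g', δ', hg⟩ := hg
  obtain ⟨G, _, _, h, h', δ'', rfl, _, _, hr, _⟩ := Extriangulated.et4 hf hg
  exact ⟨G, h', δ'', hr⟩

theorem IsDeflation.comp {A B C : 𝒞} {f : A ⟶ B} {g : B ⟶ C} (hf : IsDeflation f)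
    (hg : IsDeflation g) : IsDeflation (f ≫ g) := by
  obtain ⟨D, f', δ, hf⟩ := hf
  obtain ⟨F, g', δ', hg⟩ := hg
  obtain ⟨G, _, _, h', h, δ'', rfl, _, _, hr, _⟩ := Extriangulated.et4_op hf hg
  exact ⟨G, h', δ'', hr⟩

theorem isDeflation_snd (A C : 𝒞) : IsDeflation (biprod.snd : A ⊞ C ⟶ C) :=
  ⟨A, biprod.inl, 0, Extriangulated.realizes_zero A C⟩

theorem isInflation_of_iso {A B : 𝒞} (e : A ≅ B) : IsInflation e.hom := by
  obtain ⟨Z, hZ⟩ := (inferInstance : HasZeroObject 𝒞)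
  refine ⟨Z, 0, 0, (Extriangulated.realizes_zero A Z).trans (Quotient.sound ?_)⟩
  exact ⟨⟨biprod.fst ≫ e.hom, e.inv ≫ biprod.inl, by
    ext <;> simp [hZ.eq_of_src (biprod.inr : Z ⟶ A ⊞ Z) 0], by simp⟩,
    by simp, hZ.eq_of_tgt _ _⟩

theorem isDeflation_of_iso {A B : 𝒞} (e : A ≅ B) : IsDeflation e.hom := by
  obtain ⟨Z, hZ⟩ := (inferInstance : HasZeroObject 𝒞)
  refine ⟨Z, 0, 0, (Extriangulated.realizes_zero Z B).trans (Quotient.sound ?_)⟩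
  exact ⟨⟨biprod.snd ≫ e.inv, e.hom ≫ biprod.inr, by
    ext <;> simp [hZ.eq_of_src (biprod.inl : Z ⟶ Z ⊞ B) 0], by simp⟩,
    hZ.eq_of_src _ _, by simp⟩

theorem IsInflation.map {A B A' B' : 𝒞} {f : A ⟶ B} {g : A' ⟶ B'} (hf : IsInflation f)
    (hg : IsInflation g) : IsInflation (biprod.map f g) := by
  obtain ⟨D, f', δ, hf⟩ := hf
  obtain ⟨F, g', δ', hg⟩ := hg
  exact ⟨_, _, _, Extriangulated.realizes_sum hf hg⟩

theorem IsDeflation.map {A B A' B' : 𝒞} {f : A ⟶ B} {g : A' ⟶ B'} (hf : IsDeflation f)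
    (hg : IsDeflation g) : IsDeflation (biprod.map f g) := by
  obtain ⟨D, f', δ, hf⟩ := hf
  obtain ⟨F, g', δ', hg⟩ := hg
  exact ⟨_, _, _, Extriangulated.realizes_sum hf hg⟩

/-- The automorphism `(a, b) ↦ (a + h b, b)` of a direct sum. -/
@[simps]
noncomputable def upperShear {A B : 𝒞} (h : B ⟶ A) : A ⊞ B ≅ A ⊞ B where
  hom := biprod.desc biprod.inl (biprod.lift h (𝟙 B))
  inv := biprod.desc biprod.inl (biprod.lift (-h) (𝟙 B))
  hom_inv_id := by ext <;> simp
  inv_hom_id := by ext <;> simp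

/-- The automorphism `(a, b) ↦ (a, b + h a)` of a direct sum. -/
@[simps]
noncomputable def lowerShear {A B : 𝒞} (h : A ⟶ B) : A ⊞ B ≅ A ⊞ B where
  hom := biprod.desc (biprod.lift (𝟙 A) h) biprod.inr
  inv := biprod.desc (biprod.lift (𝟙 A) (-h)) biprod.inr
  hom_inv_id := by ext <;> simp
  inv_hom_id := by ext <;> simp

/-- A triangular matrix with deflations on its diagonal is a deflation. -/
theorem IsDeflation.triangular {A B A' B' : 𝒞} {f : A ⟶ B} {g : A' ⟶ B'} (hf : IsDeflation f)
    (hg : IsDeflation g) (h : A' ⟶ B) :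
    IsDeflation (biprod.desc (f ≫ biprod.inl) (biprod.lift h g)) := by
  have := ((hf.map (isDeflation_of_iso (Iso.refl A'))).comp
    (isDeflation_of_iso (upperShear h))).comp ((isDeflation_of_iso (Iso.refl B)).map hg)
  convert this using 1
  ext <;> simp

/-- A triangular matrix with inflations on its diagonal is an inflation. -/
theorem IsInflation.triangular {A B A' B' : 𝒞} {f : A ⟶ B} {g : A' ⟶ B'} (hf : IsInflation f)
    (hg : IsInflation g) (h : A ⟶ B') :
    IsInflation (biprod.desc (biprod.lift f h) (g ≫ biprod.inr)) := by
  have := (((isInflation_of_iso (Iso.refl A)).map hg).comp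
    (isInflation_of_iso (lowerShear h))).comp (hf.map (isInflation_of_iso (Iso.refl B')))
  convert this using 1
  ext <;> simp

/-- A pair of morphisms to the same object is a deflation as soon as one of them is. -/
theorem IsDeflation.desc {A B C : 𝒞} (f : A ⟶ C) {g : B ⟶ C} (hg : IsDeflation g) :
    IsDeflation (biprod.desc f g) := by
  have := (((isDeflation_of_iso (Iso.refl A)).map hg).comp
    (isDeflation_of_iso (lowerShear f))).comp (isDeflation_snd A C)
  convert this using 1
  ext <;> simp

theorem Realizes.comp_eq_zero {A B C : 𝒞} {x : A ⟶ B} {y : B ⟶ C} {δ : Ex C A}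
    (h : Realizes x y δ) : x ≫ y = 0 := by
  obtain ⟨Z, hZ⟩ := (inferInstance : HasZeroObject 𝒞)
  obtain ⟨c, -, hc⟩ := Extriangulated.et3 (Extriangulated.realizes_zero A Z) h (𝟙 A)
    (biprod.fst ≫ x) (by simp)
  simpa using (congrArg (biprod.inl ≫ ·) hc).symm

theorem Realizes.exists_lift_of_comp_eq_zero {A B C W : 𝒞} {x : A ⟶ B} {y : B ⟶ C} {δ : Ex C A}
    (h : Realizes x y δ) (k : W ⟶ B) (hk : k ≫ y = 0) : ∃ l : W ⟶ A, l ≫ x = k := by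
  obtain ⟨Z, hZ⟩ := (inferInstance : HasZeroObject 𝒞)
  obtain ⟨a, -, ha⟩ := Extriangulated.et3_op (Extriangulated.realizes_zero W Z) h (biprod.fst ≫ k) 0
    (by simp [hk])
  exact ⟨a, by simpa using ha.symm⟩

end Deflations

/-! ### The classes `𝒳_n^∨` and `𝒳_n^∧` of a cluster tilting subcategory -/

namespace IsClusterTilting

variable {𝒞 : Type u} [SmallCategory 𝒞] [Preadditive 𝒞] [HasFiniteBiproducts 𝒞]
  [Extriangulated 𝒞] [EnoughEInjectives 𝒞] {n : ℕ} {𝒳 : ObjectProperty 𝒞}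

theorem subsingleton_ex (h : IsClusterTilting n 𝒳) {X Y : 𝒞} (hX : 𝒳 X) (hY : 𝒳 Y) :
    Subsingleton (Ex X Y) :=
  h.isRigid 0 (Nat.zero_le n) X Y hX hY

/-- The dimension shift: an object with `E^k(L, 𝒳) = 0` for `1 ≤ k ≤ n + 1 - m` has an
`𝒳`-coresolution of length `m`, as the cokernel of an `𝒳`-preenvelope of it satisfies the same
condition for `m - 1`. -/
theorem hasCoresolution (h : IsClusterTilting n 𝒳) (m : ℕ) (hm : m ≤ n) :
    ∀ L : 𝒞, (∀ i, i + m ≤ n → ∀ Y, 𝒳 Y → Subsingleton (higherE i L Y)) →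
      HasCoresolution 𝒳 m L := by
  induction m with
  | zero => exact fun L hL => ⟨L, (h.left_perp L).2 hL, ⟨Iso.refl L⟩⟩
  | succ m ih =>
    intro L hL
    obtain ⟨X, N, x, y, hX, ⟨θ, hθ⟩, hpre⟩ := h.preenveloping L
    refine ⟨X, N, x, y, hX, ih (by omega) N fun i hi Y hY => ?_, θ, hθ⟩
    refine subsingleton_of_forall_eq_zero fun η => ?_
    have hs : Subsingleton (higherE i X Y) := h.isRigid i (by omega) X Y hX hY
    obtain ⟨f, rfl⟩ := exists_push hθ η (hs.elim _ _)
    cases i with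
    | zero =>
      obtain ⟨f', rfl⟩ := hpre Y hY f
      exact (push_comp x f' θ).trans
        ((congrArg (push f') (push_inflation hθ)).trans (push_zero f'))
    | succ i =>
      have hs' := hL i (by omega) Y hY
      have hI := cosyzygy_spec (cosyzygy^[i] Y)
      rw [← Function.iterate_succ_apply' cosyzygy i Y] at hI
      obtain ⟨I, u, v, hI, δ, hδ⟩ := hI
      obtain ⟨g, rfl⟩ := exists_lift hδ f (hs'.elim _ _)
      rw [push_comp, hI.ex_eq_zero (push g θ), push_zero]

/-- The dual dimension shift, along the kernels of `𝒳`-precovers and in terms of syzygies. -/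
theorem hasResolution [EnoughEProjectives 𝒞] (h : IsClusterTilting n 𝒳) (m : ℕ) (hm : m ≤ n) :
    ∀ L : 𝒞, (∀ i, i + m ≤ n → ∀ Y, 𝒳 Y → Subsingleton (Ex (syzygy^[i] Y) L)) →
      HasResolution 𝒳 m L := by
  induction m with
  | zero =>
    exact fun L hL => ⟨L, (h.right_perp L).2 fun i hi Y hY =>
      (subsingleton_syzygy_iterate_iff i Y L).1 (hL i hi Y hY), ⟨Iso.refl L⟩⟩
  | succ m ih =>
    intro L hL
    obtain ⟨K, X, x, y, hX, ⟨θ, hθ⟩, hpre⟩ := h.precovering L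
    refine ⟨K, X, x, y, hX, ih (by omega) K fun i hi Y hY => ?_, θ, hθ⟩
    refine subsingleton_of_forall_eq_zero fun η => ?_
    have hs : Subsingleton (Ex (syzygy^[i] Y) X) :=
      (subsingleton_syzygy_iterate_iff i Y X).2 (h.isRigid i (by omega) Y X hY hX)
    obtain ⟨f, rfl⟩ := exists_pull hθ η (hs.elim _ _)
    cases i with
    | zero =>
      obtain ⟨f', rfl⟩ := hpre Y hY f
      exact (pull_comp y f' θ).trans
        ((congrArg (pull f') (pull_deflation hθ)).trans (pull_zero f'))
    | succ i =>
      have hs' := hL i (by omega) Y hY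
      have hP := syzygy_spec (syzygy^[i] Y)
      rw [← Function.iterate_succ_apply' syzygy i Y] at hP
      obtain ⟨P, u, v, hP, δ, hδ⟩ := hP
      obtain ⟨g, rfl⟩ := exists_ext hδ f (hs'.elim _ _)
      rw [pull_comp, hP.ex_eq_zero (pull g θ), pull_zero]

/-- `𝒳_n^∨` is the class of the objects `V` with `E(V, 𝒳) = 0`. -/
theorem vee_iff (h : IsClusterTilting n 𝒳) (V : 𝒞) :
    vee 𝒳 n V ↔ ∀ Y, 𝒳 Y → Subsingleton (Ex V Y) := by
  refine ⟨fun hV Y hY => h.isRigid.vee_left hV hY, fun hV => ⟨n, le_rfl,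
    h.hasCoresolution n le_rfl V fun i hi Y hY => ?_⟩⟩
  obtain rfl : i = 0 := by omega
  exact hV Y hY

/-- `𝒳_n^∧` is the class of the objects `W` with `E(𝒳, W) = 0`. -/
theorem wedge_iff [EnoughEProjectives 𝒞] (h : IsClusterTilting n 𝒳) (W : 𝒞) :
    wedge 𝒳 n W ↔ ∀ Y, 𝒳 Y → Subsingleton (Ex Y W) := by
  refine ⟨fun hW Y hY => h.isRigid.wedge_right hW hY, fun hW => ⟨n, le_rfl,
    h.hasResolution n le_rfl W fun i hi Y hY => ?_⟩⟩
  obtain rfl : i = 0 := by omega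
  exact hW Y hY

end IsClusterTilting

/-! ### Direct sums and weak idempotent completeness -/

section Additivity

variable {𝒞 : Type u} [SmallCategory 𝒞] [Preadditive 𝒞] [HasFiniteBiproducts 𝒞]
  [Extriangulated 𝒞]

theorem add_pull {A C C' : 𝒞} (c c' : C' ⟶ C) (δ : Ex C A) :
    pull (c + c') δ = pull c δ + pull c' δ := by
  have h : ExtData.E.map (c + c').op = ExtData.E.map c.op + ExtData.E.map c'.op :=
    Functor.map_add (f := c.op) (g := c'.op) _
  exact ConcreteCategory.congr_hom (NatTrans.congr_app h A) δ

theorem add_push {A A' C : 𝒞} (a a' : A ⟶ A') (δ : Ex C A) :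
    push (a + a') δ = push a δ + push a' δ :=
  ConcreteCategory.congr_hom ((ExtData.E.obj (op C)).map_add (f := a) (g := a')) δ

theorem zero_pull {A C C' : 𝒞} (δ : Ex C A) : pull (0 : C' ⟶ C) δ = 0 := by
  simpa using add_pull (0 : C' ⟶ C) 0 δ

theorem zero_push {A A' C : 𝒞} (δ : Ex C A) : push (0 : A ⟶ A') δ = 0 := by
  simpa using add_push (0 : A ⟶ A') 0 δ

theorem subsingleton_ex_biprod_left {A A' B : 𝒞} (h : Subsingleton (Ex A B))
    (h' : Subsingleton (Ex A' B)) : Subsingleton (Ex (A ⊞ A') B) := by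
  refine subsingleton_of_forall_eq_zero fun η => ?_
  rw [← pull_id η, ← biprod.total, add_pull, pull_comp, pull_comp,
    h.elim (pull biprod.inl η) 0, h'.elim (pull biprod.inr η) 0, pull_zero, pull_zero, add_zero]

theorem subsingleton_ex_biprod_right {A B B' : 𝒞} (h : Subsingleton (Ex A B))
    (h' : Subsingleton (Ex A B')) : Subsingleton (Ex A (B ⊞ B')) := by
  refine subsingleton_of_forall_eq_zero fun η => ?_
  rw [← push_id η, ← biprod.total, add_push, push_comp, push_comp,
    h.elim (push biprod.fst η) 0, h'.elim (push biprod.snd η) 0, push_zero, push_zero, add_zero]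

theorem subsingleton_ex_zero_left {Z B : 𝒞} (hZ : IsZero Z) : Subsingleton (Ex Z B) :=
  subsingleton_of_forall_eq_zero fun η => by
    rw [← pull_id η, hZ.eq_of_src (𝟙 Z) 0, zero_pull]

theorem subsingleton_ex_zero_right {Z A : 𝒞} (hZ : IsZero Z) : Subsingleton (Ex A Z) :=
  subsingleton_of_forall_eq_zero fun η => by
    rw [← push_id η, hZ.eq_of_src (𝟙 Z) 0, zero_push]

theorem hasBinaryBiproducts_op (A : Type*) [Category A] [Preadditive A] [HasFiniteBiproducts A] :
    HasBinaryBiproducts Aᵒᵖ := by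
  have : HasFiniteBiproducts Aᵒᵖ := HasFiniteBiproducts.of_hasFiniteProducts
  infer_instance

/-- A full subcategory that is closed under finite direct sums has finite direct sums. -/
theorem hasFiniteBiproducts_fullSubcategory {A : Type*} [Category A] [Preadditive A]
    [HasFiniteBiproducts A] (𝒴 : ObjectProperty A) (hz : ∀ Z, IsZero Z → 𝒴 Z)
    (hs : ∀ Z W, 𝒴 Z → 𝒴 W → 𝒴 (Z ⊞ W)) : HasFiniteBiproducts 𝒴.FullSubcategory := by
  have : HasBinaryBiproducts 𝒴.FullSubcategory := ⟨fun S T =>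
    hasBinaryBiproduct_of_total (BinaryBicone.mk (P := S) (Q := T)
      ⟨S.obj ⊞ T.obj, hs _ _ S.property T.property⟩ (ObjectProperty.homMk biprod.fst)
      (ObjectProperty.homMk biprod.snd) (ObjectProperty.homMk biprod.inl)
      (ObjectProperty.homMk biprod.inr) (ObjectProperty.hom_ext _ (by simp))
      (ObjectProperty.hom_ext _ (by simp)) (ObjectProperty.hom_ext _ (by simp))
      (ObjectProperty.hom_ext _ (by simp))) (ObjectProperty.hom_ext _ biprod.total)⟩
  have : HasZeroObject 𝒴.FullSubcategory := by
    obtain ⟨Z, hZ⟩ := (inferInstance : HasZeroObject A)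
    exact ⟨⟨Z, hz Z hZ⟩, (IsZero.iff_id_eq_zero _).2
      (ObjectProperty.hom_ext _ (hZ.eq_of_src _ _))⟩
  have := hasFiniteProducts_of_has_binary_and_terminal (C := 𝒴.FullSubcategory)
  exact HasFiniteBiproducts.of_hasFiniteProducts

end Additivity

namespace IsClusterTilting

variable {𝒞 : Type u} [SmallCategory 𝒞] [Preadditive 𝒞] [HasFiniteBiproducts 𝒞]
  [Extriangulated 𝒞] [EnoughEInjectives 𝒞] {n : ℕ} {𝒳 : ObjectProperty 𝒞}

theorem of_isZero (h : IsClusterTilting n 𝒳) {Z : 𝒞} (hZ : IsZero Z) : 𝒳 Z :=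
  (h.left_perp Z).2 fun _ _ _ _ => subsingleton_ex_zero_left hZ

theorem biprod (h : IsClusterTilting n 𝒳) {X Y : 𝒞} (hX : 𝒳 X) (hY : 𝒳 Y) : 𝒳 (X ⊞ Y) :=
  (h.left_perp _).2 fun i hi W hW =>
    subsingleton_ex_biprod_left ((h.left_perp X).1 hX i hi W hW) ((h.left_perp Y).1 hY i hi W hW)

/-- As `𝒳` is closed under direct sums, the ideal `[𝒳]` consists of the morphisms that factor
through an object of `𝒳`. -/
theorem mem_iff (h : IsClusterTilting n 𝒳) {A B : 𝒞} (f : A ⟶ B) :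
    f ∈ (factorIdeal 𝒳).mor A B ↔ ∃ (Z : 𝒞) (g : A ⟶ Z) (k : Z ⟶ B), 𝒳 Z ∧ g ≫ k = f :=
  mem_factorIdeal_iff 𝒳
    (let ⟨Z, hZ⟩ := (inferInstance : HasZeroObject 𝒞); ⟨Z, h.of_isZero hZ⟩)
    (fun _ _ => h.biprod) f

theorem map_eq_zero_iff (h : IsClusterTilting n 𝒳) {A B : 𝒞} (f : A ⟶ B) :
    (CategoryTheory.Quotient.functor (factorIdeal 𝒳).rel).map f = 0 ↔
      ∃ (Z : 𝒞) (g : A ⟶ Z) (k : Z ⟶ B), 𝒳 Z ∧ g ≫ k = f := by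
  have := CategoryTheory.Quotient.functor_map_eq_iff (factorIdeal 𝒳).rel f 0
  rw [Functor.map_zero] at this
  rw [this, ← h.mem_iff, HomIdeal.rel, sub_zero]

/-- The quotient category `𝒞 / [𝒳]` is weakly idempotent complete: after a summand in `𝒳` has been
added to its source, a split epimorphism of `𝒞 / [𝒳]` lifts to a deflation of `𝒞` that splits, and
the kernel of this deflation is a kernel in the quotient. -/
theorem isWeaklyIdempotentComplete (h : IsClusterTilting n 𝒳) :
    IsWeaklyIdempotentComplete (QuotBy 𝒳) := by
  rintro ⟨A⟩ ⟨B⟩ f ⟨⟨s⟩⟩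
  let q := CategoryTheory.Quotient.functor (factorIdeal 𝒳).rel
  obtain ⟨f, rfl⟩ := q.map_surjective (X := A) (Y := B) f
  obtain ⟨σ, hσ⟩ := s
  obtain ⟨g, rfl⟩ := q.map_surjective (X := B) (Y := A) σ
  -- A right inverse modulo `𝒳` becomes a right inverse after adding an `𝒳`-precover.
  have h₁ : q.map (𝟙 B - g ≫ f) = 0 := by
    rw [q.map_sub, q.map_comp, sub_eq_zero]
    exact (q.map_id B).trans hσ.symm
  obtain ⟨Z, a, b, hZ, hab⟩ := (h.map_eq_zero_iff _).1 h₁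
  obtain ⟨K, X, k, x, hX, hx, hpre⟩ := h.precovering B
  obtain ⟨b', rfl⟩ := hpre Z hZ b
  obtain ⟨N, i, δ, hδ⟩ := IsDeflation.desc f ⟨K, k, hx⟩
  have hs : biprod.lift g (a ≫ b') ≫ biprod.desc f x = 𝟙 B := by
    rw [biprod.lift_desc, Category.assoc, hab, add_sub_cancel]
  have hδ0 : δ = 0 := by
    rw [← pull_id δ, ← hs, pull_comp, pull_deflation hδ, pull_zero]
  obtain ⟨r, hr⟩ := exists_ext hδ (𝟙 N) (by rw [hδ0, push_zero])
  have hw : i ≫ biprod.desc f x = 0 := Realizes.comp_eq_zero hδ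
  have hw' : q.map (i ≫ biprod.fst) ≫ q.map f = 0 := by
    rw [← q.map_comp, h.map_eq_zero_iff]
    refine ⟨X, -(i ≫ biprod.snd), x, hX, ?_⟩
    rw [Preadditive.neg_comp, ← sub_eq_zero, ← neg_eq_zero, ← hw, biprod.desc_eq]
    simp
  have : Mono (q.map (i ≫ biprod.fst)) := by
    refine Preadditive.mono_of_cancel_zero _ fun {W} l hl => ?_
    obtain ⟨W⟩ := W
    obtain ⟨l, rfl⟩ := q.map_surjective (X := W) (Y := N) l
    rw [← q.map_comp] at hl
    have h₂ : l = (l ≫ i ≫ biprod.fst) ≫ biprod.inl ≫ r +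
        (l ≫ i ≫ biprod.snd) ≫ biprod.inr ≫ r := by
      calc l = l ≫ i ≫ (biprod.fst ≫ biprod.inl + biprod.snd ≫ biprod.inr) ≫ r := by
            rw [biprod.total, Category.id_comp, hr, Category.comp_id]
        _ = _ := by simp only [Preadditive.add_comp, Preadditive.comp_add, Category.assoc]
    rw [h₂, q.map_add, q.map_comp, hl, zero_comp, zero_add, h.map_eq_zero_iff]
    exact ⟨X, l ≫ i ≫ biprod.snd, biprod.inr ≫ r, hX, rfl⟩
  refine ⟨⟨_, KernelFork.IsLimit.ofι' (q.map (i ≫ biprod.fst)) hw' fun {W} l hl =>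
    Classical.choice ?_⟩⟩
  obtain ⟨W⟩ := W
  obtain ⟨l, rfl⟩ := q.map_surjective (X := W) (Y := A) l
  rw [← q.map_comp, h.map_eq_zero_iff] at hl
  obtain ⟨Z, c, d, hZ, hcd⟩ := hl
  obtain ⟨d', rfl⟩ := hpre Z hZ d
  obtain ⟨m, hm⟩ := hδ.exists_lift_of_comp_eq_zero (biprod.lift l (-(c ≫ d')))
    (by rw [biprod.lift_desc, ← hcd]; simp)
  exact ⟨q.map m, by rw [← q.map_comp, ← Category.assoc, hm, biprod.lift_fst]⟩

theorem vee_hasFiniteBiproducts (h : IsClusterTilting n 𝒳) :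
    HasFiniteBiproducts (vee 𝒳 n).FullSubcategory :=
  hasFiniteBiproducts_fullSubcategory _
    (fun Z hZ => (h.vee_iff Z).2 fun _ _ => subsingleton_ex_zero_left hZ)
    (fun Z W hZ hW => (h.vee_iff _).2 fun Y hY => subsingleton_ex_biprod_left
      ((h.vee_iff Z).1 hZ Y hY) ((h.vee_iff W).1 hW Y hY))

theorem wedge_hasFiniteBiproducts [EnoughEProjectives 𝒞] (h : IsClusterTilting n 𝒳) :
    HasFiniteBiproducts (wedge 𝒳 n).FullSubcategory :=
  hasFiniteBiproducts_fullSubcategory _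
    (fun Z hZ => (h.wedge_iff Z).2 fun _ _ => subsingleton_ex_zero_right hZ)
    (fun Z W hZ hW => (h.wedge_iff _).2 fun Y hY => subsingleton_ex_biprod_right
      ((h.wedge_iff Z).1 hZ Y hY) ((h.wedge_iff W).1 hW Y hY))

end IsClusterTilting

/-! ### The functor `F` -/

section StableMaps

variable {𝒞 : Type u} [SmallCategory 𝒞] [Preadditive 𝒞] [HasFiniteBiproducts 𝒞]
  [Extriangulated 𝒞] {𝒴 : ObjectProperty 𝒞}

/-- An object of `𝒴`, seen in the opposite of the stable category of `𝒴`. -/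
abbrev stab {V : 𝒞} (hV : 𝒴 V) : (Stable 𝒴)ᵒᵖ := op ⟨⟨V, hV⟩⟩

/-- The class of a morphism between objects of `𝒴` in the opposite of the stable category. -/
def stabMap {V W : 𝒞} (hV : 𝒴 V) (hW : 𝒴 W) (c : V ⟶ W) : stab hW ⟶ stab hV :=
  ((CategoryTheory.Quotient.functor (projIdeal 𝒴).rel).map
    (ObjectProperty.homMk c : (⟨V, hV⟩ : 𝒴.FullSubcategory) ⟶ ⟨W, hW⟩)).op

theorem exists_stabMap {V W : 𝒞} (hV : 𝒴 V) (hW : 𝒴 W) (f : stab hW ⟶ stab hV) :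
    ∃ c : V ⟶ W, stabMap hV hW c = f := by
  obtain ⟨c, hc⟩ := (CategoryTheory.Quotient.functor (projIdeal 𝒴).rel).map_surjective
    (show (CategoryTheory.Quotient.functor (projIdeal 𝒴).rel).obj (⟨V, hV⟩ : 𝒴.FullSubcategory) ⟶
      (CategoryTheory.Quotient.functor (projIdeal 𝒴).rel).obj ⟨W, hW⟩ from f.unop)
  exact ⟨c.hom, congrArg Quiver.Hom.op hc⟩

theorem stabMap_comp {U V W : 𝒞} (hU : 𝒴 U) (hV : 𝒴 V) (hW : 𝒴 W) (c : U ⟶ V) (d : V ⟶ W) :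
    stabMap hV hW d ≫ stabMap hU hV c = stabMap hU hW (c ≫ d) :=
  rfl

theorem stabMap_id {V : 𝒞} (hV : 𝒴 V) : stabMap hV hV (𝟙 V) = 𝟙 (stab hV) := rfl

theorem stabMap_add {V W : 𝒞} (hV : 𝒴 V) (hW : 𝒴 W) (c d : V ⟶ W) :
    stabMap hV hW (c + d) = stabMap hV hW c + stabMap hV hW d :=
  rfl

theorem stabMap_sub {V W : 𝒞} (hV : 𝒴 V) (hW : 𝒴 W) (c d : V ⟶ W) :
    stabMap hV hW (c - d) = stabMap hV hW c - stabMap hV hW d := by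
  rw [eq_sub_iff_add_eq, ← stabMap_add, sub_add_cancel]

theorem stabMap_zero {V W : 𝒞} (hV : 𝒴 V) (hW : 𝒴 W) : stabMap hV hW 0 = 0 := by
  rw [← sub_self (0 : V ⟶ W), stabMap_sub, sub_self]

/-- The direct sum of two objects of `𝒴`, as a bicone in the opposite of the stable category. -/
noncomputable def stabBicone {V W : 𝒞} (hV : 𝒴 V) (hW : 𝒴 W) (hVW : 𝒴 (V ⊞ W)) :
    BinaryBicone (stab hV) (stab hW) where
  pt := stab hVW
  fst := stabMap hV hVW biprod.inl
  snd := stabMap hW hVW biprod.inr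
  inl := stabMap hVW hV biprod.fst
  inr := stabMap hVW hW biprod.snd
  inl_fst := by rw [stabMap_comp, biprod.inl_fst, stabMap_id]
  inl_snd := by rw [stabMap_comp, biprod.inr_fst, stabMap_zero]
  inr_fst := by rw [stabMap_comp, biprod.inl_snd, stabMap_zero]
  inr_snd := by rw [stabMap_comp, biprod.inr_snd, stabMap_id]

end StableMaps

theorem vee_of_mem {𝒞 : Type u} [SmallCategory 𝒞] [Preadditive 𝒞] [HasFiniteBiproducts 𝒞]
    [Extriangulated 𝒞] {n : ℕ} {𝒳 : ObjectProperty 𝒞} {X : 𝒞} (hX : 𝒳 X) : vee 𝒳 n X :=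
  ⟨0, Nat.zero_le n, X, hX, ⟨Iso.refl X⟩⟩

namespace IsClusterTilting

variable {𝒞 : Type u} [SmallCategory 𝒞] [Preadditive 𝒞] [HasFiniteBiproducts 𝒞]
  [Extriangulated 𝒞] [EnoughEInjectives 𝒞] {n : ℕ} {𝒳 : ObjectProperty 𝒞}

/-- The cokernel of an `𝒳`-preenvelope lies in `𝒳_n^∨`. -/
theorem exists_conflation_vee (h : IsClusterTilting n 𝒳) (M : 𝒞) :
    ∃ (X L : 𝒞) (x : M ⟶ X) (y : X ⟶ L) (δ : Ex L M), 𝒳 X ∧ vee 𝒳 n L ∧ Realizes x y δ := by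
  obtain ⟨X, L, x, y, hX, ⟨δ, hδ⟩, hpre⟩ := h.preenveloping M
  refine ⟨X, L, x, y, δ, hX, (h.vee_iff L).2 fun Y hY => ?_, hδ⟩
  refine subsingleton_of_forall_eq_zero fun η => ?_
  obtain ⟨f, rfl⟩ := exists_push hδ η ((h.subsingleton_ex hX hY).elim _ _)
  obtain ⟨f', rfl⟩ := hpre Y hY f
  rw [push_comp, push_inflation hδ, push_zero]

/-- A conflation `M ⟶ X ⟶ L` with `X` in `𝒳` and `L` in `𝒳_n^∨` gives a presentation of `F(M)`. -/
theorem isPresentedBy_functorF (h : IsClusterTilting n 𝒳) {M X L : 𝒞} {x : M ⟶ X} {y : X ⟶ L}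
    {δ : Ex L M} (hX : 𝒳 X) (hL : vee 𝒳 n L) (hδ : Realizes x y δ) :
    IsPresentedBy (stabMap (vee_of_mem hX) hL y) ((functorF n 𝒳 h.isRigid).obj ⟨M⟩) δ := by
  refine .of_map_eq_zero (pull_deflation hδ) ?_ ?_
  · rintro ⟨⟨⟨V, hV⟩⟩⟩ (ξ : Ex V M)
    obtain ⟨c, rfl⟩ := exists_pull hδ ξ (((h.vee_iff V).1 hV X hX).elim _ _)
    exact ⟨stabMap hV hL c, rfl⟩
  · rintro ⟨⟨⟨V, hV⟩⟩⟩ c hc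
    obtain ⟨c, rfl⟩ := exists_stabMap hV hL c
    obtain ⟨t, rfl⟩ := exists_lift hδ c hc
    exact ⟨stabMap hV (vee_of_mem hX) t, rfl⟩

/-- A morphism that kills the generator of `F(M)` factors through an object of `𝒳`. -/
theorem functorF_faithful (h : IsClusterTilting n 𝒳) : (functorF n 𝒳 h.isRigid).Faithful where
  map_injective {M N} f g hfg := by
    obtain ⟨M⟩ := M
    obtain ⟨N⟩ := N
    obtain ⟨f, rfl⟩ := (CategoryTheory.Quotient.functor (factorIdeal 𝒳).rel).map_surjective
      (X := M) (Y := N) f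
    obtain ⟨g, rfl⟩ := (CategoryTheory.Quotient.functor (factorIdeal 𝒳).rel).map_surjective
      (X := M) (Y := N) g
    obtain ⟨X, L, x, y, δ, hX, hL, hδ⟩ := h.exists_conflation_vee M
    have hp : push f δ = push g δ :=
      ConcreteCategory.congr_hom (NatTrans.congr_app hfg (stab hL)) δ
    have hp' : push (f - g) δ = 0 := by
      rw [← add_right_cancel_iff (a := push g δ), ← add_push, sub_add_cancel, zero_add, hp]
    obtain ⟨k, hk⟩ := exists_ext hδ (f - g) hp'
    rw [← sub_eq_zero, ← Functor.map_sub, h.map_eq_zero_iff]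
    exact ⟨X, x, k, hX, hk⟩

/-- The image of the generator of `F(M)` under a morphism of modules `F(M) ⟶ F(N)` is the pushout of
the generator along a morphism `M ⟶ N`. -/
theorem functorF_full (h : IsClusterTilting n 𝒳) : (functorF n 𝒳 h.isRigid).Full where
  map_surjective {M N} τ := by
    obtain ⟨M⟩ := M
    obtain ⟨N⟩ := N
    obtain ⟨X, L, x, y, δ, hX, hL, hδ⟩ := h.exists_conflation_vee M
    have hτ {V : 𝒞} (hV : vee 𝒳 n V) (c : V ⟶ L) :
        τ.app (stab hV) (pull c δ : Ex V M) = (pull c (τ.app (stab hL) δ : Ex L N) : Ex V N) :=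
      app_map _ _ τ (stabMap hV hL c) δ
    obtain ⟨a, ha⟩ := exists_push hδ (τ.app (stab hL) δ : Ex L N)
      (by rw [← hτ (vee_of_mem hX), pull_deflation hδ]; exact map_zero _)
    refine ⟨(CategoryTheory.Quotient.functor (factorIdeal 𝒳).rel).map a, ?_⟩
    ext ⟨⟨⟨V, hV⟩⟩⟩ (ξ : Ex V M)
    obtain ⟨c, rfl⟩ := exists_pull hδ ξ (((h.vee_iff V).1 hV X hX).elim _ _)
    change push a (pull c δ) = _
    rw [hτ hV, ha, pull_push]

/-- The essential image of `F` is closed under extensions: the triangular matrix that presents an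
extension is represented by a deflation between an object of `𝒳` and an object of `𝒳_n^∨`. -/
theorem functorF_essImage_isClosedUnderExtensions (h : IsClusterTilting n 𝒳) :
    (functorF n 𝒳 h.isRigid).essImage.IsClosedUnderExtensions where
  prop_X₂_of_shortExact {E} hE := by
    rintro ⟨⟨M'⟩, ⟨e'⟩⟩ ⟨⟨M''⟩, ⟨e''⟩⟩
    obtain ⟨X', L', x', y', δ', hX', hL', hδ'⟩ := h.exists_conflation_vee M'
    obtain ⟨X'', L'', x'', y'', δ'', hX'', hL'', hδ''⟩ := h.exists_conflation_vee M''
    have : E.X₁.Additive := Functor.additive_of_iso e'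
    have : E.X₃.Additive := Functor.additive_of_iso e''
    have := h.vee_hasFiniteBiproducts
    have := hasBinaryBiproducts_op (Stable (vee 𝒳 n))
    have : E.X₂.Additive := additive_of_shortExact hE
    obtain ⟨k, hk⟩ := ((h.isPresentedBy_functorF hX' hL' hδ').of_iso e').exists_extension hE
      ((h.isPresentedBy_functorF hX'' hL'' hδ'').of_iso e'')
    obtain ⟨k, rfl⟩ := exists_stabMap (vee_of_mem hX'') hL' k
    have hL : vee 𝒳 n (L' ⊞ L'') := (h.vee_iff _).2 fun Y hY =>
      subsingleton_ex_biprod_left ((h.vee_iff L').1 hL' Y hY) ((h.vee_iff L'').1 hL'' Y hY)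
    have hX := h.biprod hX' hX''
    obtain ⟨M, x, δ, hδ⟩ := IsDeflation.triangular ⟨_, x', _, hδ'⟩ ⟨_, x'', _, hδ''⟩ (-k)
    have h₁ : stabMap hL hL (biprod.fst ≫ biprod.inl + biprod.snd ≫ biprod.inr) = 𝟙 (stab hL) := by
      rw [biprod.total, stabMap_id]
    have h₂ : biprod.desc (y' ≫ biprod.inl) (biprod.lift (-k) y'') ≫ biprod.fst =
        biprod.fst ≫ y' - biprod.snd ≫ k := by ext <;> simp
    have h₃ : biprod.desc (y' ≫ biprod.inl) (biprod.lift (-k) y'') ≫ biprod.snd =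
        biprod.snd ≫ y'' := by ext <;> simp
    have h₂' := congrArg (stabMap (vee_of_mem hX) hL') h₂
    rw [stabMap_sub] at h₂'
    obtain ⟨z, hz⟩ := hk (stabBicone hL' hL'' hL)
      (stabBicone (vee_of_mem hX') (vee_of_mem hX'') (vee_of_mem hX))
      (stabMap (vee_of_mem hX) hL (biprod.desc (y' ≫ biprod.inl) (biprod.lift (-k) y''))) h₁ h₂'
      (congrArg (stabMap (vee_of_mem hX) hL'') h₃)
    exact ⟨⟨M⟩, (h.isPresentedBy_functorF hX hL hδ).nonempty_iso hz⟩

theorem isExactStructure_epsF (h : IsClusterTilting n 𝒳) :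
    IsExactStructure (epsF n 𝒳 h.isRigid) := by
  have := h.functorF_faithful
  have := h.functorF_full
  have := h.functorF_essImage_isClosedUnderExtensions
  exact isExactStructure_shortExactClass (functorF n 𝒳 h.isRigid)

end IsClusterTilting

/-! ### The functor `K` -/

section CostableMaps

variable {𝒞 : Type u} [SmallCategory 𝒞] [Preadditive 𝒞] [HasFiniteBiproducts 𝒞]
  [Extriangulated 𝒞] {𝒴 : ObjectProperty 𝒞}

/-- An object of `𝒴`, seen in the costable category of `𝒴`. -/
abbrev costab {V : 𝒞} (hV : 𝒴 V) : Costable 𝒴 := ⟨⟨V, hV⟩⟩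

/-- The class of a morphism between objects of `𝒴` in the costable category. -/
def costabMap {V W : 𝒞} (hV : 𝒴 V) (hW : 𝒴 W) (c : V ⟶ W) : costab hV ⟶ costab hW :=
  (CategoryTheory.Quotient.functor (injIdeal 𝒴).rel).map
    (ObjectProperty.homMk c : (⟨V, hV⟩ : 𝒴.FullSubcategory) ⟶ ⟨W, hW⟩)

theorem exists_costabMap {V W : 𝒞} (hV : 𝒴 V) (hW : 𝒴 W) (f : costab hV ⟶ costab hW) :
    ∃ c : V ⟶ W, costabMap hV hW c = f := by
  obtain ⟨c, hc⟩ := (CategoryTheory.Quotient.functor (injIdeal 𝒴).rel).map_surjective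
    (show (CategoryTheory.Quotient.functor (injIdeal 𝒴).rel).obj (⟨V, hV⟩ : 𝒴.FullSubcategory) ⟶
      (CategoryTheory.Quotient.functor (injIdeal 𝒴).rel).obj ⟨W, hW⟩ from f)
  exact ⟨c.hom, hc⟩

theorem costabMap_comp {U V W : 𝒞} (hU : 𝒴 U) (hV : 𝒴 V) (hW : 𝒴 W) (c : U ⟶ V) (d : V ⟶ W) :
    costabMap hU hV c ≫ costabMap hV hW d = costabMap hU hW (c ≫ d) :=
  rfl

theorem costabMap_id {V : 𝒞} (hV : 𝒴 V) : costabMap hV hV (𝟙 V) = 𝟙 (costab hV) := rfl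

theorem costabMap_add {V W : 𝒞} (hV : 𝒴 V) (hW : 𝒴 W) (c d : V ⟶ W) :
    costabMap hV hW (c + d) = costabMap hV hW c + costabMap hV hW d :=
  rfl

theorem costabMap_sub {V W : 𝒞} (hV : 𝒴 V) (hW : 𝒴 W) (c d : V ⟶ W) :
    costabMap hV hW (c - d) = costabMap hV hW c - costabMap hV hW d := by
  rw [eq_sub_iff_add_eq, ← costabMap_add, sub_add_cancel]

theorem costabMap_zero {V W : 𝒞} (hV : 𝒴 V) (hW : 𝒴 W) : costabMap hV hW 0 = 0 := by
  rw [← sub_self (0 : V ⟶ W), costabMap_sub, sub_self]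

/-- The direct sum of two objects of `𝒴`, as a bicone in the costable category. -/
noncomputable def costabBicone {V W : 𝒞} (hV : 𝒴 V) (hW : 𝒴 W) (hVW : 𝒴 (V ⊞ W)) :
    BinaryBicone (costab hV) (costab hW) where
  pt := costab hVW
  fst := costabMap hVW hV biprod.fst
  snd := costabMap hVW hW biprod.snd
  inl := costabMap hV hVW biprod.inl
  inr := costabMap hW hVW biprod.inr
  inl_fst := by rw [costabMap_comp, biprod.inl_fst, costabMap_id]
  inl_snd := by rw [costabMap_comp, biprod.inl_snd, costabMap_zero]
  inr_fst := by rw [costabMap_comp, biprod.inr_fst, costabMap_zero]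
  inr_snd := by rw [costabMap_comp, biprod.inr_snd, costabMap_id]

end CostableMaps

theorem wedge_of_mem {𝒞 : Type u} [SmallCategory 𝒞] [Preadditive 𝒞] [HasFiniteBiproducts 𝒞]
    [Extriangulated 𝒞] {n : ℕ} {𝒳 : ObjectProperty 𝒞} {X : 𝒞} (hX : 𝒳 X) : wedge 𝒳 n X :=
  ⟨0, Nat.zero_le n, X, hX, ⟨Iso.refl X⟩⟩

namespace IsClusterTilting

variable {𝒞 : Type u} [SmallCategory 𝒞] [Preadditive 𝒞] [HasFiniteBiproducts 𝒞]
  [Extriangulated 𝒞] [EnoughEInjectives 𝒞] [EnoughEProjectives 𝒞] {n : ℕ} {𝒳 : ObjectProperty 𝒞}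

/-- The kernel of an `𝒳`-precover lies in `𝒳_n^∧`. -/
theorem exists_conflation_wedge (h : IsClusterTilting n 𝒳) (M : 𝒞) :
    ∃ (L X : 𝒞) (x : L ⟶ X) (y : X ⟶ M) (δ : Ex M L), 𝒳 X ∧ wedge 𝒳 n L ∧ Realizes x y δ := by
  obtain ⟨L, X, x, y, hX, ⟨δ, hδ⟩, hpre⟩ := h.precovering M
  refine ⟨L, X, x, y, δ, hX, (h.wedge_iff L).2 fun Y hY => ?_, hδ⟩
  refine subsingleton_of_forall_eq_zero fun η => ?_
  obtain ⟨f, rfl⟩ := exists_pull hδ η ((h.subsingleton_ex hY hX).elim _ _)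
  obtain ⟨f', rfl⟩ := hpre Y hY f
  rw [pull_comp, pull_deflation hδ, pull_zero]

/-- A conflation `L ⟶ X ⟶ M` with `X` in `𝒳` and `L` in `𝒳_n^∧` gives a presentation of `K(M)`. -/
theorem isPresentedBy_functorK (h : IsClusterTilting n 𝒳) {M X L : 𝒞} {x : L ⟶ X} {y : X ⟶ M}
    {δ : Ex M L} (hX : 𝒳 X) (hL : wedge 𝒳 n L) (hδ : Realizes x y δ) :
    IsPresentedBy (costabMap hL (wedge_of_mem hX) x)
      ((functorK n 𝒳 h.isRigid).obj (op ⟨M⟩)) δ := by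
  refine .of_map_eq_zero (push_inflation hδ) ?_ ?_
  · rintro ⟨⟨V, hV⟩⟩ (ξ : Ex M V)
    obtain ⟨c, rfl⟩ := exists_push hδ ξ (((h.wedge_iff V).1 hV X hX).elim _ _)
    exact ⟨costabMap hL hV c, rfl⟩
  · rintro ⟨⟨V, hV⟩⟩ c hc
    obtain ⟨c, rfl⟩ := exists_costabMap hL hV c
    obtain ⟨t, rfl⟩ := exists_ext hδ c hc
    exact ⟨costabMap (wedge_of_mem hX) hV t, rfl⟩

/-- A morphism that kills the generator of `K(N)` factors through an object of `𝒳`. -/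
theorem functorK_faithful (h : IsClusterTilting n 𝒳) : (functorK n 𝒳 h.isRigid).Faithful where
  map_injective {N M} f g hfg := by
    obtain ⟨⟨M⟩⟩ := M
    obtain ⟨⟨N⟩⟩ := N
    obtain ⟨f, rfl⟩ : ∃ f', f = Quiver.Hom.op f' := ⟨f.unop, rfl⟩
    obtain ⟨g, rfl⟩ : ∃ g', g = Quiver.Hom.op g' := ⟨g.unop, rfl⟩
    obtain ⟨f, rfl⟩ := (CategoryTheory.Quotient.functor (factorIdeal 𝒳).rel).map_surjective
      (X := M) (Y := N) f
    obtain ⟨g, rfl⟩ := (CategoryTheory.Quotient.functor (factorIdeal 𝒳).rel).map_surjective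
      (X := M) (Y := N) g
    obtain ⟨L, X, x, y, δ, hX, hL, hδ⟩ := h.exists_conflation_wedge N
    have hp : pull f δ = pull g δ :=
      ConcreteCategory.congr_hom (NatTrans.congr_app hfg (costab hL)) δ
    have hp' : pull (f - g) δ = 0 := by
      rw [← add_right_cancel_iff (a := pull g δ), ← add_pull, sub_add_cancel, zero_add, hp]
    obtain ⟨k, hk⟩ := exists_lift hδ (f - g) hp'
    congr 1
    rw [← sub_eq_zero, ← Functor.map_sub, h.map_eq_zero_iff]
    exact ⟨X, k, y, hX, hk⟩

/-- The image of the generator of `K(N)` under a morphism of modules `K(N) ⟶ K(M)` is the pullback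
of the generator along a morphism `M ⟶ N`. -/
theorem functorK_full (h : IsClusterTilting n 𝒳) : (functorK n 𝒳 h.isRigid).Full where
  map_surjective {N M} τ := by
    obtain ⟨⟨M⟩⟩ := M
    obtain ⟨⟨N⟩⟩ := N
    obtain ⟨L, X, x, y, δ, hX, hL, hδ⟩ := h.exists_conflation_wedge N
    have hτ {V : 𝒞} (hV : wedge 𝒳 n V) (c : L ⟶ V) :
        τ.app (costab hV) (push c δ : Ex N V) = (push c (τ.app (costab hL) δ : Ex M L) : Ex M V) :=
      app_map _ _ τ (costabMap hL hV c) δ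
    obtain ⟨a, ha⟩ := exists_pull hδ (τ.app (costab hL) δ : Ex M L)
      (by rw [← hτ (wedge_of_mem hX), push_inflation hδ]; exact map_zero _)
    refine ⟨((CategoryTheory.Quotient.functor (factorIdeal 𝒳).rel).map a).op, ?_⟩
    ext ⟨⟨V, hV⟩⟩ (ξ : Ex N V)
    obtain ⟨c, rfl⟩ := exists_push hδ ξ (((h.wedge_iff V).1 hV X hX).elim _ _)
    change pull a (push c δ) = _
    rw [hτ hV, ha, pull_push]

/-- The essential image of `K` is closed under extensions: the triangular matrix that presents an
extension is represented by an inflation between an object of `𝒳_n^∧` and an object of `𝒳`. -/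
theorem functorK_essImage_isClosedUnderExtensions (h : IsClusterTilting n 𝒳) :
    (functorK n 𝒳 h.isRigid).essImage.IsClosedUnderExtensions where
  prop_X₂_of_shortExact {E} hE := by
    rintro ⟨⟨⟨M'⟩⟩, ⟨e'⟩⟩ ⟨⟨⟨M''⟩⟩, ⟨e''⟩⟩
    obtain ⟨L', X', x', y', δ', hX', hL', hδ'⟩ := h.exists_conflation_wedge M'
    obtain ⟨L'', X'', x'', y'', δ'', hX'', hL'', hδ''⟩ := h.exists_conflation_wedge M''
    have : E.X₁.Additive := Functor.additive_of_iso e'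
    have : E.X₃.Additive := Functor.additive_of_iso e''
    have := h.wedge_hasFiniteBiproducts
    have : E.X₂.Additive := additive_of_shortExact hE
    obtain ⟨k, hk⟩ := ((h.isPresentedBy_functorK hX' hL' hδ').of_iso e').exists_extension hE
      ((h.isPresentedBy_functorK hX'' hL'' hδ'').of_iso e'')
    obtain ⟨k, rfl⟩ := exists_costabMap hL' (wedge_of_mem hX'') k
    have hL : wedge 𝒳 n (L' ⊞ L'') := (h.wedge_iff _).2 fun Y hY =>
      subsingleton_ex_biprod_right ((h.wedge_iff L').1 hL' Y hY) ((h.wedge_iff L'').1 hL'' Y hY)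
    have hX := h.biprod hX' hX''
    obtain ⟨M, y, δ, hδ⟩ := IsInflation.triangular ⟨_, y', _, hδ'⟩ ⟨_, y'', _, hδ''⟩ (-k)
    have h₁ : costabMap hL hL (biprod.fst ≫ biprod.inl + biprod.snd ≫ biprod.inr) =
        𝟙 (costab hL) := by
      rw [biprod.total, costabMap_id]
    have h₂ : biprod.inl ≫ biprod.desc (biprod.lift x' (-k)) (x'' ≫ biprod.inr) =
        x' ≫ biprod.inl - k ≫ biprod.inr := by ext <;> simp
    have h₃ : biprod.inr ≫ biprod.desc (biprod.lift x' (-k)) (x'' ≫ biprod.inr) =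
        x'' ≫ biprod.inr := by ext <;> simp
    have h₂' := congrArg (costabMap hL' (wedge_of_mem hX)) h₂
    rw [costabMap_sub] at h₂'
    obtain ⟨z, hz⟩ := hk (costabBicone hL' hL'' hL)
      (costabBicone (wedge_of_mem hX') (wedge_of_mem hX'') (wedge_of_mem hX))
      (costabMap hL (wedge_of_mem hX) (biprod.desc (biprod.lift x' (-k)) (x'' ≫ biprod.inr)))
      h₁ h₂' (congrArg (costabMap hL'' (wedge_of_mem hX)) h₃)
    exact ⟨op ⟨M⟩, (h.isPresentedBy_functorK hX hL hδ).nonempty_iso hz⟩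

/-- The same for the covariant form of `K`, with values in the opposite of the category of modules:
this is the embedding that induces `ε_K`, see `epsK_eq`. -/
theorem rightOp_functorK_essImage_isClosedUnderExtensions (h : IsClusterTilting n 𝒳) :
    (functorK n 𝒳 h.isRigid).rightOp.essImage.IsClosedUnderExtensions where
  prop_X₂_of_shortExact {E} hE := by
    rintro ⟨M', ⟨e'⟩⟩ ⟨M'', ⟨e''⟩⟩
    have := h.functorK_essImage_isClosedUnderExtensions
    obtain ⟨M, ⟨e⟩⟩ := (functorK n 𝒳 h.isRigid).essImage.prop_X₂_of_shortExact hE.unop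
      ⟨op M'', ⟨e''.symm.unop⟩⟩ ⟨op M', ⟨e'.symm.unop⟩⟩
    exact ⟨M.unop, ⟨e.symm.op⟩⟩

theorem epsK_eq (h : IsClusterTilting n 𝒳) :
    epsK n 𝒳 h.isRigid = shortExactClass (functorK n 𝒳 h.isRigid).rightOp := by
  ext S
  exact ShortComplex.shortExact_iff_op _

theorem isExactStructure_epsK (h : IsClusterTilting n 𝒳) :
    IsExactStructure (epsK n 𝒳 h.isRigid) := by
  have := h.functorK_faithful
  have := h.functorK_full
  have := h.rightOp_functorK_essImage_isClosedUnderExtensions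
  rw [h.epsK_eq]
  exact isExactStructure_shortExactClass (functorK n 𝒳 h.isRigid).rightOp

end IsClusterTilting

end ExtriCat

theorem mainTheorem10 {𝒞 : Type u} [SmallCategory 𝒞] [Preadditive 𝒞] [HasFiniteBiproducts 𝒞]
    [ExtriCat.Extriangulated 𝒞] [ExtriCat.EnoughEProjectives 𝒞] [ExtriCat.EnoughEInjectives 𝒞]
    (n : ℕ) (𝒳 : ObjectProperty 𝒞) (h𝒳 : ExtriCat.IsClusterTilting n 𝒳) :
    (ExtriCat.IsWeaklyIdempotentComplete (ExtriCat.QuotBy 𝒳) ∧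
      ExtriCat.IsExactStructure (ExtriCat.epsF n 𝒳 h𝒳.isRigid) ∧
      ExtriCat.IsExactStructure (ExtriCat.epsK n 𝒳 h𝒳.isRigid)) ∧
    ExtriCat.splitConflations (ExtriCat.epsF n 𝒳 h𝒳.isRigid) =
      ExtriCat.splitConflations (ExtriCat.epsK n 𝒳 h𝒳.isRigid) ∧
    Nonempty (Abelian (ExtriCat.ConflationsModSplit (ExtriCat.epsF n 𝒳 h𝒳.isRigid))) ∧
    Nonempty (Abelian (ExtriCat.ConflationsModSplit (ExtriCat.epsK n 𝒳 h𝒳.isRigid))) := by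
  have hF := h𝒳.isExactStructure_epsF
  have hK := h𝒳.isExactStructure_epsK
  exact ⟨⟨h𝒳.isWeaklyIdempotentComplete, hF, hK⟩,
    hF.splitConflations_eq.trans hK.splitConflations_eq.symm, hF.abelian, hK.abelian⟩
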